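/- Let $d\ge 1$ and $b\ge 2$ be integers. Let $H:[0,1]\to[0,1]^d$ be a Hilbert space filling curve, i.e. the limit of recursive curves given as follows: for every $m\ge 0$ there is a bijection between the $2^{dm}$ intervals $[k2^{-dm},(k+1)2^{-dm}]$ and the $2^{dm}$ subcubes of $[0,1]^d$ with side $2^{-m}$, such that consecutive intervals correspond to subcubes with a common $(d-1)$-dimensional face, and the $2^d$ successive level-$(m+1)$ subintervals of an interval correspond to subcubes of the subcube of that interval; $H(x)$ is the point common to the nested subcubes corresponding to the intervals that contain $x$ (one interval per level; at each common endpoint of two intervals take the right one). For $d=1$ this is $H(x)=x$, up to reflection. Write $i-1=\sum_{j\ge1}a_{ij}b^{j-1}$ with $a_{ij}\in\{0,\dots,b-1\}$ for $i\ge1$, and let $\pi_w$, for all finite strings $w$ of digits in $\{0,\dots,b-1\}$, be mutually independent random permutations of $\{0,\dots,b-1\}$, each uniformly distributed over the $b!$ permutations. The scrambled van der Corput sequence is $x_i=\sum_{j\ge1}\pi_{a_{i1}\dots a_{i,j-1}}(a_{ij})\,b^{-j}$. For $f:[0,1]^d\to\mathbb R$ put $$\mu=\int_{[0,1]^d}f(X)\,\mathrm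 dX,\qquad \hat\mu_n=\frac1n\sum_{i=1}^n f(H(x_i)).$$ For $n=b^m$ let $E_i=H\left(\left[\frac{i-1}n,\frac in\right]\right)$, $1\le i\le n$, and let $X^{(i)}$ be uniformly distributed on $E_i$. For a measurable set $\Omega\subset[0,1]^d$ let $$\mathcal T_{\mathrm{bdy}}=\mathcal T_{\mathrm{bdy}}(n)=\{1\le i\le n: E_i\cap\Omega\ne\emptyset,\ E_i\not\subset\Omega\}.$$ **Theorem.** Let $f=1_\Omega$, where $\Omega\subset[0,1]^d$ is measurable. Assume that there are a constant $c>0$ and an $N_0\ge1$ such that, for all $n=b^m\ge N_0$, $$\inf_{i\in\mathcal T_{\mathrm{bdy}}}\mathrm{Var}\big(1_\Omega(X^{(i)})\big)\ge c,$$ and that $|\mathcal T_{\mathrm{bdy}}|\to\infty$ as $n=b^m\to\infty$ (with $\inf\emptyset=+\infty$). Then $$\frac{\hat\mu_n-\mu}{\sqrt{\mathrm{Var}(\hat\mu_n)}}\to N(0,1)$$ in distribution as $n=b^m\to\infty$. -/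

import Mathlib

open MeasureTheory ProbabilityTheory Filter Topology

namespace HSFC

/-! ### Hilbert's space filling curve -/

/-- The recursive orderings that define a Hilbert curve in dimension `d`. At level `m` the interval
`[0,1]` is divided into the `2 ^ (d * m)` intervals `[k / 2 ^ (d * m), (k + 1) / 2 ^ (d * m)]` and
the cube `[0,1]^d` into the `2 ^ (d * m)` subcubes `∏ j, [κ j / 2 ^ m, (κ j + 1) / 2 ^ m]`; the
`k`-th interval is assigned the subcube with index vector `κ = cell m k`.
* `bijOn`: every subcube is assigned to exactly one interval;
* `adjacent`: the subcubes of consecutive intervals share a `(d - 1)`-dimensional face;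
* `nested`: the `2 ^ d` successive subintervals of an interval are assigned subcubes of the subcube
  of that interval.
For `d = 1` this gives `H x = x`, up to the reflection `H x = 1 - x`. -/
structure HilbertScheme (d : ℕ) where
  cell : ℕ → ℕ → Fin d → ℕ
  bijOn : ∀ m, Set.BijOn (cell m) (Set.Iio (2 ^ (d * m))) {κ | ∀ j, κ j < 2 ^ m}
  adjacent : ∀ m k, k + 1 < 2 ^ (d * m) → ∃ j,
    (cell m (k + 1) j = cell m k j + 1 ∨ cell m k j = cell m (k + 1) j + 1) ∧
      ∀ l, l ≠ j → cell m (k + 1) l = cell m k l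
  nested : ∀ m k, k < 2 ^ (d * (m + 1)) → ∀ j, cell (m + 1) k j / 2 = cell m (k / 2 ^ d) j

/-- The index of an interval `[k / 2 ^ (d * m), (k + 1) / 2 ^ (d * m)]` that contains
`x ∈ [0,1]`. -/
noncomputable def intervalIndex (d m : ℕ) (x : ℝ) : ℕ :=
  min ⌊x * 2 ^ (d * m)⌋₊ (2 ^ (d * m) - 1)

/-- The Hilbert curve `H : [0,1] → [0,1]^d` of a scheme, as the limit of the recursive curves:
`H x` is the limit of the (coordinatewise nondecreasing) lower corners of the subcubes that are
assigned to the intervals containing `x`. It is the point common to all these subcubes, see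
`HilbertScheme.curve_mem`. -/
noncomputable def HilbertScheme.curve {d : ℕ} (S : HilbertScheme d) (x : ℝ) : Fin d → ℝ :=
  fun j => ⨆ m : ℕ, (S.cell m (intervalIndex d m x) j : ℝ) / 2 ^ m

theorem intervalIndex_lt (d m : ℕ) (x : ℝ) : intervalIndex d m x < 2 ^ (d * m) := by
  have : 0 < 2 ^ (d * m) := by positivity
  unfold intervalIndex
  omega

theorem intervalIndex_div (d m : ℕ) (x : ℝ) :
    intervalIndex d (m + 1) x / 2 ^ d = intervalIndex d m x := by
  have hp : 0 < 2 ^ (d * m) := by positivity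
  have hq : 0 < 2 ^ d := by positivity
  have hf : ⌊x * 2 ^ (d * (m + 1))⌋₊ / 2 ^ d = ⌊x * 2 ^ (d * m)⌋₊ := by
    have := Nat.floor_div_natCast (x * 2 ^ (d * (m + 1))) (2 ^ d)
    rw [← this]
    congr 1
    push_cast
    rw [Nat.mul_succ, pow_add]
    field_simp
  have hs : (2 ^ (d * (m + 1)) - 1) / 2 ^ d = 2 ^ (d * m) - 1 := by
    have e : 2 ^ (d * (m + 1)) = 2 ^ (d * m) * 2 ^ d := by rw [← pow_add]; rfl
    have h1 : 2 ^ (d * (m + 1)) - 1 = 2 ^ d * (2 ^ (d * m) - 1) + (2 ^ d - 1) := by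
      have h2 : 1 * 2 ^ d ≤ 2 ^ (d * m) * 2 ^ d := Nat.mul_le_mul_right _ hp
      rw [e, Nat.mul_sub, mul_comm (2 ^ d) (2 ^ (d * m))]
      omega
    rw [h1, Nat.mul_add_div hq, Nat.div_eq_of_lt (show 2 ^ d - 1 < 2 ^ d by omega), add_zero]
  unfold intervalIndex
  rw [← hf, ← hs]
  exact Monotone.map_min (f := fun a : ℕ => a / 2 ^ d) fun _ _ h => Nat.div_le_div_right h

/-- `H x` lies in every subcube assigned to an interval that `x` is counted to. -/
theorem HilbertScheme.curve_mem {d : ℕ} (S : HilbertScheme d) (m : ℕ) (x : ℝ) (j : Fin d) :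
    S.curve x j ∈ Set.Icc ((S.cell m (intervalIndex d m x) j : ℝ) / 2 ^ m)
      ((S.cell m (intervalIndex d m x) j + 1 : ℝ) / 2 ^ m) := by
  set u : ℕ → ℕ := fun m => S.cell m (intervalIndex d m x) j with hu
  have hstep : ∀ m, u (m + 1) / 2 = u m := fun m => by
    rw [hu]
    simp only
    rw [S.nested m _ (intervalIndex_lt d (m + 1) x) j, intervalIndex_div]
  have hlow : Monotone fun m => (u m : ℝ) / 2 ^ m := monotone_nat_of_le_succ fun m => by
    have h : 2 * u m ≤ u (m + 1) := by have := hstep m; omega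
    have h' : 2 * (u m : ℝ) ≤ u (m + 1) := by exact_mod_cast h
    rw [pow_succ, div_le_div_iff₀ (by positivity) (by positivity)]
    nlinarith [pow_pos (two_pos : (0 : ℝ) < 2) m]
  have hupp : Antitone fun m => ((u m : ℝ) + 1) / 2 ^ m := antitone_nat_of_succ_le fun m => by
    have h : u (m + 1) + 1 ≤ 2 * (u m + 1) := by have := hstep m; omega
    have h' : (u (m + 1) : ℝ) + 1 ≤ 2 * (u m + 1) := by exact_mod_cast h
    rw [pow_succ, div_le_div_iff₀ (by positivity) (by positivity)]
    nlinarith [pow_pos (two_pos : (0 : ℝ) < 2) m]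
  have hle : ∀ k m, (u k : ℝ) / 2 ^ k ≤ ((u m : ℝ) + 1) / 2 ^ m := fun k m => by
    refine (hlow (le_max_left k m)).trans (le_trans ?_ (hupp (le_max_right k m)))
    exact div_le_div_of_nonneg_right (by linarith) (by positivity)
  exact ⟨le_ciSup (f := fun m => (u m : ℝ) / 2 ^ m) ⟨_, by rintro _ ⟨k, rfl⟩; exact hle k m⟩ m,
    ciSup_le fun k => hle k m⟩

/-! ### Existence of Hilbert schemes -/

/-- The `i`-th binary digit of the `l`-th vertex of the reflected Gray code. -/
def gray (l i : ℕ) : ℕ := (l / 2 ^ i + l / 2 ^ (i + 1)) % 2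

/-- The coordinate in which the Gray code vertices `l` and `l + 1` differ. -/
def grayChange (l : ℕ) : ℕ := if l % 2 = 0 then 0 else grayChange (l / 2) + 1
termination_by l
decreasing_by omega

/-- The corner of the `l`-th subcube at which the standard Hilbert curve enters. -/
def entry (l i : ℕ) : ℕ := if l = 0 then 0 else gray (2 * ((l - 1) / 2)) i

/-- The coordinate in which entry and exit corner of the `l`-th subcube differ. -/
def travel (d l : ℕ) : ℕ :=
  if l = 0 ∨ l + 1 = 2 ^ d then 0 else if l % 2 = 0 then grayChange (l - 1) else grayChange l

/-- The standard (Gray code) Hilbert ordering: in the `l`-th of the `2 ^ d` subcubes, visited in Gray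
code order, one places a copy of the ordering of level `m`, rotated and reflected so that it runs
from the entry corner to the exit corner. -/
def stdCell (d : ℕ) : ℕ → ℕ → ℕ → ℕ
  | 0, _, _ => 0
  | m + 1, k, i =>
    2 ^ m * gray (k / 2 ^ (d * m)) i +
      (if entry (k / 2 ^ (d * m)) i = 1 then
        2 ^ m - 1 - stdCell d m (k % 2 ^ (d * m)) (Equiv.swap (d - 1) (travel d (k / 2 ^ (d * m))) i)
      else stdCell d m (k % 2 ^ (d * m)) (Equiv.swap (d - 1) (travel d (k / 2 ^ (d * m))) i))

theorem gray_lt (l i : ℕ) : gray l i < 2 := Nat.mod_lt _ (by norm_num)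

theorem gray_succ (l i : ℕ) : gray l (i + 1) = gray (l / 2) i := by
  unfold gray
  simp only [Nat.div_div_eq_div_mul, ← pow_succ']

theorem gray_zero (l : ℕ) : gray l 0 = (l + l / 2) % 2 := by simp [gray]

theorem gray_inj (d : ℕ) : ∀ l l', l < 2 ^ d → l' < 2 ^ d → (∀ i < d, gray l i = gray l' i) →
    l = l' := by
  induction d with
  | zero => intro l l' h h' _; simp at h h'; omega
  | succ d ih =>
    intro l l' h h' hg
    have e := ih (l / 2) (l' / 2) (by rw [pow_succ] at h; omega) (by rw [pow_succ] at h'; omega)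
      (fun i hi => by rw [← gray_succ, ← gray_succ]; exact hg _ (by omega))
    have e0 := hg 0 (by omega)
    rw [gray_zero, gray_zero] at e0
    omega

theorem grayChange_even {l : ℕ} (h : l % 2 = 0) : grayChange l = 0 := by
  rw [grayChange, if_pos h]

theorem grayChange_odd {l : ℕ} (h : l % 2 = 1) : grayChange l = grayChange (l / 2) + 1 := by
  rw [grayChange, if_neg (by omega)]

theorem grayChange_lt (d : ℕ) : ∀ l, l + 1 < 2 ^ d → grayChange l < d := by
  induction d with
  | zero => intro l h; simp at h
  | succ d ih =>
    intro l h
    rcases Nat.mod_two_eq_zero_or_one l with h0 | h0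
    · rw [grayChange_even h0]; omega
    · rw [grayChange_odd h0]
      have := ih (l / 2) (by rw [pow_succ] at h; omega)
      omega

theorem gray_step (i : ℕ) : ∀ l, gray (l + 1) i =
    if i = grayChange l then 1 - gray l i else gray l i := by
  induction i with
  | zero =>
    intro l
    rcases Nat.mod_two_eq_zero_or_one l with h0 | h0
    · rw [grayChange_even h0, if_pos rfl, gray_zero, gray_zero]; omega
    · rw [grayChange_odd h0, if_neg (by omega), gray_zero, gray_zero]; omega
  | succ i ih =>
    intro l
    rw [gray_succ, gray_succ]
    rcases Nat.mod_two_eq_zero_or_one l with h0 | h0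
    · rw [grayChange_even h0, if_neg (by omega), show (l + 1) / 2 = l / 2 by omega]
    · rw [grayChange_odd h0, show (l + 1) / 2 = l / 2 + 1 by omega, ih]
      simp

theorem gray_last (d : ℕ) : ∀ i, gray (2 ^ d - 1) i = if i + 1 = d then 1 else 0 := by
  induction d with
  | zero => intro i; simp [gray]
  | succ d ih =>
    intro i
    have hp : 0 < 2 ^ d := by positivity
    have h2 : (2 ^ (d + 1) - 1) / 2 = 2 ^ d - 1 := by rw [pow_succ]; omega
    cases i with
    | zero =>
      rw [gray_zero, h2]
      cases d with
      | zero => simp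
      | succ d => rw [if_neg (by omega)]; rw [pow_succ, pow_succ]; omega
    | succ i => rw [gray_succ, h2, ih]; simp

/-- The corner of the `l`-th subcube at which the standard Hilbert curve exits. -/
def exit (d l i : ℕ) : ℕ := if i = travel d l then 1 - entry l i else entry l i

theorem entry_lt (l i : ℕ) : entry l i < 2 := by
  unfold entry; split_ifs
  · norm_num
  · exact gray_lt _ _

theorem travel_lt {d l : ℕ} (hd : 1 ≤ d) (hl : l < 2 ^ d) : travel d l < d := by
  unfold travel
  split_ifs with h1 h2
  · omega
  · exact grayChange_lt d _ (by omega)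
  · exact grayChange_lt d _ (by omega)

theorem entry_succ {d l : ℕ} (hl : l + 1 < 2 ^ d) (i : ℕ) :
    (exit d l (grayChange l) = gray (l + 1) (grayChange l)) ∧
    entry (l + 1) i = if i = grayChange l then gray l i else exit d l i := by
  rcases Nat.even_or_odd' l with ⟨q, rfl | rfl⟩
  · have hc : grayChange (2 * q) = 0 := grayChange_even (by omega)
    have hs := gray_step
    rw [hc]
    have e1 : entry (2 * q + 1) i = gray (2 * q) i := by
      unfold entry; rw [if_neg (by omega)]; congr 1; omega
    rw [e1]
    rcases Nat.eq_zero_or_pos q with rfl | hq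
    · constructor
      · simp [exit, travel, entry, gray]
      · simp only [exit, travel, entry, gray]; simp; 
    · obtain ⟨p, rfl⟩ : ∃ p, q = p + 1 := ⟨q - 1, by omega⟩
      have ht : travel d (2 * (p + 1)) = grayChange (2 * p + 1) := by
        unfold travel; rw [if_neg (by omega), if_pos (by omega)]; congr 1
      have e0 : ∀ i, entry (2 * (p + 1)) i = gray (2 * p) i := by
        intro i
        unfold entry; rw [if_neg (by omega)]; congr 1; omega
      have hodd : grayChange (2 * p + 1) ≠ 0 := by rw [grayChange_odd (by omega)]; omega
      have g1 := fun i => gray_step i (2 * p)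
      have g2 := fun i => gray_step i (2 * p + 1)
      have g3 := fun i => gray_step i (2 * (p + 1))
      rw [hc] at g3
      rw [grayChange_even (l := 2 * p) (by omega)] at g1
      have hb := fun i => gray_lt (2 * p) i
      simp only [exit, ht, e0]
      have hg : ∀ i, gray (2 * (p + 1)) i = gray (2 * p + 1 + 1) i := fun i => rfl
      constructor
      · rw [if_neg (Ne.symm hodd), g3, if_pos rfl, hg, g2, if_neg (Ne.symm hodd), g1, if_pos rfl]
        have := hb 0; omega
      · by_cases hi : i = 0
        · simp [hi]
        · rw [if_neg hi, hg, g2, g1, if_neg hi]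
  · have hce : grayChange (2 * q) = 0 := grayChange_even (by omega)
    have hodd : grayChange (2 * q + 1) ≠ 0 := by rw [grayChange_odd (by omega)]; omega
    have ht : travel d (2 * q + 1) = grayChange (2 * q + 1) := by
      unfold travel; rw [if_neg (by omega), if_neg (by omega)]
    have e0 : ∀ i, entry (2 * q + 1) i = gray (2 * q) i := by
      intro i
      unfold entry; rw [if_neg (by omega)]; congr 1; omega
    have e1 : ∀ i, entry (2 * q + 1 + 1) i = gray (2 * q) i := by
      intro i
      unfold entry; rw [if_neg (by omega)]; congr 1; omega
    have g1 := fun i => gray_step i (2 * q)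
    rw [hce] at g1
    simp only [exit, ht, e0, e1]
    constructor
    · rw [gray_step, if_pos rfl, g1, if_neg hodd]; simp
    · by_cases hi : i = grayChange (2 * q + 1)
      · rw [if_pos hi, g1, if_neg (by omega)]
      · rw [if_neg hi, if_neg hi]

theorem exit_last {d : ℕ} (hd : 1 ≤ d) (i : ℕ) :
    exit d (2 ^ d - 1) i = if i = d - 1 then 1 else 0 := by
  obtain ⟨e, rfl⟩ : ∃ e, d = e + 1 := ⟨d - 1, by omega⟩
  have hp : 0 < 2 ^ e := by positivity
  have h2 : 2 ^ (e + 1) = 2 * 2 ^ e := by rw [pow_succ]; omega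
  have ht : travel (e + 1) (2 ^ (e + 1) - 1) = 0 := by
    unfold travel; rw [if_pos]; right; omega
  have he : entry (2 ^ (e + 1) - 1) i = gray (2 ^ (e + 1) - 2) i := by
    unfold entry; rw [if_neg (by omega)]; congr 1; omega
  have g := gray_step i (2 ^ (e + 1) - 2)
  rw [show 2 ^ (e + 1) - 2 + 1 = 2 ^ (e + 1) - 1 by omega, gray_last,
    grayChange_even (by omega)] at g
  have hb := gray_lt (2 ^ (e + 1) - 2) i
  unfold exit
  rw [ht, he]
  by_cases hi : i = 0
  · rw [if_pos hi] at g ⊢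
    rw [← g]; simp
  · rw [if_neg hi] at g ⊢
    rw [← g]; simp

theorem stdCell_lt (d : ℕ) : ∀ m k i, stdCell d m k i < 2 ^ m := by
  intro m
  induction m with
  | zero => intro k i; simp [stdCell]
  | succ m ih =>
    intro k i
    have h1 := ih (k % 2 ^ (d * m)) (Equiv.swap (d - 1) (travel d (k / 2 ^ (d * m))) i)
    have h2 := gray_lt (k / 2 ^ (d * m)) i
    have h3 : 2 ^ m * gray (k / 2 ^ (d * m)) i ≤ 2 ^ m * 1 := Nat.mul_le_mul_left _ (by omega)
    rw [stdCell, pow_succ]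
    split_ifs <;> omega

theorem swap_lt {d a b i : ℕ} (ha : a < d) (hb : b < d) (hi : i < d) : Equiv.swap a b i < d := by
  rw [Equiv.swap_apply_def]; split_ifs <;> omega

theorem stdCell_zero (d m i : ℕ) : stdCell d m 0 i = 0 := by
  induction m generalizing i with
  | zero => rfl
  | succ m ih => simp [stdCell, ih, gray, entry]

/-- One step of the recursion, on the `l`-th block. -/
theorem stdCell_block (d m l r i : ℕ) (hr : r < 2 ^ (d * m)) :
    stdCell d (m + 1) (2 ^ (d * m) * l + r) i = 2 ^ m * gray l i +
      (if entry l i = 1 then 2 ^ m - 1 - stdCell d m r (Equiv.swap (d - 1) (travel d l) i)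
      else stdCell d m r (Equiv.swap (d - 1) (travel d l) i)) := by
  have h1 : (2 ^ (d * m) * l + r) / 2 ^ (d * m) = l := by
    rw [Nat.mul_add_div (by positivity), Nat.div_eq_of_lt hr, add_zero]
  have h2 : (2 ^ (d * m) * l + r) % 2 ^ (d * m) = r := by
    rw [Nat.mul_add_mod, Nat.mod_eq_of_lt hr]
  rw [stdCell, h1, h2]

theorem block_first (d m l i : ℕ) :
    stdCell d (m + 1) (2 ^ (d * m) * l) i = 2 ^ m * gray l i + (2 ^ m - 1) * entry l i := by
  have h := stdCell_block d m l 0 i (by positivity)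
  rw [add_zero] at h
  have hb := entry_lt l i
  rw [h, stdCell_zero]
  split_ifs with h1
  · rw [h1]; simp
  · rw [show entry l i = 0 by omega]; simp

theorem stdCell_last {d : ℕ} (hd : 1 ≤ d) : ∀ m i, stdCell d m (2 ^ (d * m) - 1) i =
    if i = d - 1 then 2 ^ m - 1 else 0 := by
  intro m
  induction m with
  | zero => intro i; simp [stdCell]
  | succ m ih =>
    intro i
    have hp : 0 < 2 ^ (d * m) := by positivity
    have hq : 0 < 2 ^ d := by positivity
    have hm : 0 < 2 ^ m := by positivity
    have hk : 2 ^ (d * (m + 1)) - 1 = 2 ^ (d * m) * (2 ^ d - 1) + (2 ^ (d * m) - 1) := by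
      have h1 : 2 ^ (d * (m + 1)) = 2 ^ (d * m) * 2 ^ d := by rw [← pow_add]; rfl
      have h2 : 2 ^ (d * m) * 1 ≤ 2 ^ (d * m) * 2 ^ d := Nat.mul_le_mul_left _ hq
      rw [Nat.mul_sub, h1]
      omega
    rw [hk, stdCell_block _ _ _ _ _ (by omega), ih, gray_last]
    have hs : Equiv.swap (d - 1) (travel d (2 ^ d - 1)) i = d - 1 ↔ i = travel d (2 ^ d - 1) := by
      rw [Equiv.swap_apply_eq_iff, Equiv.swap_apply_left]
    have he := exit_last hd i
    have hb := entry_lt (2 ^ d - 1) i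
    unfold exit at he
    rw [pow_succ]
    simp only [hs]
    by_cases hi : i = d - 1
    · rw [if_pos hi] at he
      rw [if_pos hi, if_pos (show i + 1 = d by omega)]
      split_ifs at he ⊢ <;> omega
    · rw [if_neg hi] at he
      rw [if_neg hi, if_neg (show ¬ i + 1 = d by omega)]
      split_ifs at he ⊢ <;> omega

theorem block_last {d : ℕ} (hd : 1 ≤ d) (m l i : ℕ) :
    stdCell d (m + 1) (2 ^ (d * m) * l + (2 ^ (d * m) - 1)) i =
      2 ^ m * gray l i + (2 ^ m - 1) * exit d l i := by
  have hp : 0 < 2 ^ (d * m) := by positivity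
  rw [stdCell_block _ _ _ _ _ (by omega), stdCell_last hd]
  have hs : Equiv.swap (d - 1) (travel d l) i = d - 1 ↔ i = travel d l := by
    rw [Equiv.swap_apply_eq_iff, Equiv.swap_apply_left]
  have hb := entry_lt l i
  unfold exit
  simp only [hs]
  rcases (by omega : entry l i = 0 ∨ entry l i = 1) with h | h <;> rw [h] <;> split_ifs <;> simp_all

theorem split_index {d m k : ℕ} (hk : k < 2 ^ (d * (m + 1))) :
    ∃ l < 2 ^ d, ∃ r < 2 ^ (d * m), k = 2 ^ (d * m) * l + r := by
  refine ⟨k / 2 ^ (d * m), ?_, k % 2 ^ (d * m), Nat.mod_lt _ (by positivity),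
    (Nat.div_add_mod _ _).symm⟩
  rw [Nat.div_lt_iff_lt_mul (by positivity), ← pow_add]
  convert hk using 2; ring

theorem stdCell_inj {d : ℕ} (hd : 1 ≤ d) (m : ℕ) : ∀ k k', k < 2 ^ (d * m) → k' < 2 ^ (d * m) →
    (∀ i < d, stdCell d m k i = stdCell d m k' i) → k = k' := by
  induction m with
  | zero => intro k k' h h' _; simp at h h'; omega
  | succ m ih =>
    intro k k' h h' hg
    obtain ⟨l, hl, r, hr, rfl⟩ := split_index h
    obtain ⟨l', hl', r', hr', rfl⟩ := split_index h'
    have key : ∀ i, gray l i = gray l' i ∧ True ∨ i ≥ d := by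
      intro i
      by_cases hi : i < d
      · left
        have := hg i hi
        rw [stdCell_block _ _ _ _ _ hr, stdCell_block _ _ _ _ _ hr'] at this
        have b1 := stdCell_lt d m r (Equiv.swap (d - 1) (travel d l) i)
        have b2 := stdCell_lt d m r' (Equiv.swap (d - 1) (travel d l') i)
        have b3 := gray_lt l i
        have b4 := gray_lt l' i
        refine ⟨?_, trivial⟩
        rcases (by omega : gray l i = 0 ∨ gray l i = 1) with h1 | h1 <;>
        rcases (by omega : gray l' i = 0 ∨ gray l' i = 1) with h2 | h2 <;>
        rw [h1, h2] at this ⊢ <;> split_ifs at this <;> omega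
      · right; omega
    have hll : l = l' := gray_inj d l l' hl hl' (fun i hi => by
      rcases key i with h | h
      · exact h.1
      · omega)
    subst hll
    congr 1
    refine ih r r' hr hr' (fun i hi => ?_)
    have ht := travel_lt hd hl
    have := hg (Equiv.swap (d - 1) (travel d l) i) (swap_lt (by omega) ht hi)
    rw [stdCell_block _ _ _ _ _ hr, stdCell_block _ _ _ _ _ hr', Equiv.swap_apply_self] at this
    have b1 := stdCell_lt d m r i
    have b2 := stdCell_lt d m r' i
    split_ifs at this <;> omega

theorem stdCell_adj {d : ℕ} (hd : 1 ≤ d) (m : ℕ) : ∀ k, k + 1 < 2 ^ (d * m) → ∃ j < d,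
    (stdCell d m (k + 1) j = stdCell d m k j + 1 ∨ stdCell d m k j = stdCell d m (k + 1) j + 1) ∧
      ∀ i, i ≠ j → stdCell d m (k + 1) i = stdCell d m k i := by
  induction m with
  | zero => intro k h; simp at h
  | succ m ih =>
    intro k hk
    obtain ⟨l, hl, r, hr, rfl⟩ := split_index (show k < 2 ^ (d * (m + 1)) by omega)
    by_cases h : r + 1 < 2 ^ (d * m)
    · obtain ⟨j, hj, h1, h2⟩ := ih r h
      have ht := travel_lt hd hl
      refine ⟨Equiv.swap (d - 1) (travel d l) j, swap_lt (by omega) ht hj, ?_, ?_⟩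
      · rw [add_assoc, stdCell_block _ _ _ _ _ hr, stdCell_block _ _ _ _ _ h,
          Equiv.swap_apply_self]
        have b1 := stdCell_lt d m r j
        have b2 := stdCell_lt d m (r + 1) j
        split_ifs <;> omega
      · intro i hi
        rw [add_assoc, stdCell_block _ _ _ _ _ hr, stdCell_block _ _ _ _ _ h,
          h2 _ (fun hh => hi (by rw [← hh, Equiv.swap_apply_self]))]
    · have hr' : r = 2 ^ (d * m) - 1 := by omega
      have hp : 0 < 2 ^ (d * m) := by positivity
      have hl2 : l + 1 < 2 ^ d := by
        have : 2 ^ (d * (m + 1)) = 2 ^ (d * m) * 2 ^ d := by rw [← pow_add]; congr 1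
        rw [this, add_assoc, show r + 1 = 2 ^ (d * m) by omega, ← Nat.mul_succ] at hk
        exact Nat.lt_of_mul_lt_mul_left hk
      have e1 : 2 ^ (d * m) * l + r + 1 = 2 ^ (d * m) * (l + 1) := by
        rw [Nat.mul_succ]; omega
      have hm : 0 < 2 ^ m := by positivity
      rw [e1, hr']
      refine ⟨grayChange l, grayChange_lt d l hl2, ?_, ?_⟩
      · obtain ⟨h1, h2⟩ := entry_succ hl2 (grayChange l)
        rw [if_pos rfl] at h2
        rw [block_first, block_last hd, h1, h2, gray_step, if_pos rfl]
        have b := gray_lt l (grayChange l)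
        rcases (by omega : gray l (grayChange l) = 0 ∨ gray l (grayChange l) = 1) with h | h <;>
          rw [h] <;> simp <;> omega
      · intro i hi
        obtain ⟨_, h2⟩ := entry_succ hl2 i
        rw [if_neg hi] at h2
        rw [block_first, block_last hd, h2, gray_step, if_neg hi]

theorem stdCell_nested {d : ℕ} (m : ℕ) : ∀ k, k < 2 ^ (d * (m + 1)) → ∀ i,
    stdCell d (m + 1) k i / 2 = stdCell d m (k / 2 ^ d) i := by
  induction m with
  | zero =>
    intro k _ i
    have := stdCell_lt d 1 k i
    simp only [zero_add]
    rw [show stdCell d 0 (k / 2 ^ d) i = 0 from rfl]; omega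
  | succ m ih =>
    intro k hk i
    obtain ⟨l, hl, r, hr, rfl⟩ := split_index hk
    have e : (2 ^ (d * (m + 1)) * l + r) / 2 ^ d = 2 ^ (d * m) * l + r / 2 ^ d := by
      rw [show 2 ^ (d * (m + 1)) * l = 2 ^ d * (2 ^ (d * m) * l) by
        rw [← mul_assoc, ← pow_add]; congr 2; ring, Nat.mul_add_div (by positivity)]
    have hr2 : r / 2 ^ d < 2 ^ (d * m) := by
      rw [Nat.div_lt_iff_lt_mul (by positivity), ← pow_add]
      exact hr
    rw [e, stdCell_block _ _ _ _ _ hr, stdCell_block _ _ _ _ _ hr2, ← ih r hr]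
    have b1 := stdCell_lt d (m + 1) r (Equiv.swap (d - 1) (travel d l) i)
    have hm : 0 < 2 ^ m := by positivity
    have : 2 ^ (m + 1) * gray l i = 2 * (2 ^ m * gray l i) := by rw [pow_succ]; ring
    rw [this]
    rw [pow_succ] at b1 ⊢
    split_ifs <;> omega

/-- Hilbert schemes exist in every dimension: the standard one is an example. -/
theorem HilbertScheme.nonempty {d : ℕ} (hd : 1 ≤ d) : Nonempty (HilbertScheme d) := by
  refine ⟨⟨fun m k j => stdCell d m k j, fun m => ?_, fun m k hk => ?_, fun m k hk j => ?_⟩⟩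
  · have hinj : Set.InjOn (fun k (j : Fin d) => stdCell d m k j)
        (Finset.range (2 ^ (d * m)) : Set ℕ) := by
      intro k hk k' hk' h
      simp only [Finset.coe_range, Set.mem_Iio] at hk hk'
      exact stdCell_inj hd m k k' hk hk' (fun i hi => congrFun h ⟨i, hi⟩)
    have hmaps : Set.MapsTo (fun k (j : Fin d) => stdCell d m k j)
        (Finset.range (2 ^ (d * m)) : Set ℕ)
        (Fintype.piFinset (fun _ : Fin d => Finset.range (2 ^ m)) : Set (Fin d → ℕ)) := by
      intro k _
      simp only [Finset.mem_coe, Fintype.mem_piFinset, Finset.mem_range]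
      exact fun j => stdCell_lt d m k j
    have hs := Finset.surjOn_of_injOn_of_card_le _ hmaps hinj (by
      simp [Fintype.card_piFinset, ← pow_mul, mul_comm])
    have e1 : (Finset.range (2 ^ (d * m)) : Set ℕ) = Set.Iio (2 ^ (d * m)) := by simp
    have e2 : (Fintype.piFinset (fun _ : Fin d => Finset.range (2 ^ m)) : Set (Fin d → ℕ)) =
        {κ | ∀ j, κ j < 2 ^ m} := by ext; simp
    rw [e1] at hinj hmaps hs
    rw [e2] at hmaps hs
    exact ⟨hmaps, hinj, hs⟩
  · obtain ⟨j, hj, h1, h2⟩ := stdCell_adj hd m k hk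
    exact ⟨⟨j, hj⟩, h1, fun l hl => h2 l (fun h => hl (Fin.ext h))⟩
  · exact stdCell_nested m k hk j

/-! ### The scrambled van der Corput sequence -/

/-- The digit `a_{i,j+1}` of the `i`-th point (`i = 0, 1, …`) of the van der Corput sequence in base
`b`, where `i = ∑ j, a_{i,j+1} * b ^ j`. -/
def vdcDigit (b : ℕ) [NeZero b] (i j : ℕ) : Fin b := Fin.ofNat b (i / b ^ j)

/-- The random permutations of nested uniform scrambling in base `b`: for every finite string `w` of
digits a permutation `π w` of the digits, uniformly distributed on the `b!` permutations; all of them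
are mutually independent. -/
structure IsNestedUniformScrambling {b : ℕ} {Ω' : Type*} [MeasurableSpace Ω'] (P : Measure Ω')
    (π : List (Fin b) → Ω' → Equiv.Perm (Fin b)) : Prop where
  measurableSet_eq : ∀ w σ, MeasurableSet {ω | π w ω = σ}
  uniform : ∀ w σ, P {ω | π w ω = σ} = ((b.factorial : ℕ) : ENNReal)⁻¹
  indep : iIndepFun (m := fun _ => (⊤ : MeasurableSpace (Equiv.Perm (Fin b)))) π P

/-- The `i`-th point of the scrambled van der Corput sequence, `∑ j, x_j * b ^ (-j)` with
`x_j = π_{a_1 … a_{j-1}} (a_j)`, where `a_1, a_2, …` are the digits of the `i`-th point of the van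
der Corput sequence. -/
noncomputable def scrambledVdC {b : ℕ} [NeZero b] {Ω' : Type*}
    (π : List (Fin b) → Ω' → Equiv.Perm (Fin b)) (i : ℕ) (ω : Ω') : ℝ :=
  Real.ofDigits fun j =>
    π (List.ofFn fun l : Fin j => vdcDigit b i l) ω (vdcDigit b i j)

/-- The HSFC-based estimate `(1 / n) * ∑ f (H (x_i))` of the integral of `f` over `[0,1]^d`. -/
noncomputable def estimate {d b : ℕ} [NeZero b] {Ω' : Type*} (S : HilbertScheme d)
    (π : List (Fin b) → Ω' → Equiv.Perm (Fin b)) (f : (Fin d → ℝ) → ℝ) (n : ℕ) (ω : Ω') : ℝ :=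
  (1 / n) * ∑ i ∈ Finset.range n, f (S.curve (scrambledVdC π i ω))

/-! ### Boundary cells -/

/-- The indicator function of `Ω`. -/
noncomputable def ind {d : ℕ} (Ω : Set (Fin d → ℝ)) : (Fin d → ℝ) → ℝ :=
  Ω.indicator fun _ => 1

/-- The stratum `E_i = H ([i / n, (i + 1) / n])`, `0 ≤ i < n`. -/
def stratum {d : ℕ} (S : HilbertScheme d) (n i : ℕ) : Set (Fin d → ℝ) :=
  S.curve '' Set.Icc ((i : ℝ) / n) (((i : ℝ) + 1) / n)

/-- The indices of the strata that meet `Ω` without being contained in `Ω`. -/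
def boundaryCells {d : ℕ} (S : HilbertScheme d) (Ω : Set (Fin d → ℝ)) (n : ℕ) : Set ℕ :=
  {i | i < n ∧ (stratum S n i ∩ Ω).Nonempty ∧ ¬ stratum S n i ⊆ Ω}

/-- The variance of `1_Ω (X)` for a random vector `X` that is uniformly distributed on `E_i`. -/
noncomputable def cellVariance {d : ℕ} (S : HilbertScheme d) (Ω : Set (Fin d → ℝ)) (n i : ℕ) : ℝ :=
  variance (ind Ω) (cond volume (stratum S n i))

/-- For `n = b ^ m`: the cell variances on the boundary cells are bounded below by some `c > 0` for all
sufficiently large `n`, and the number of boundary cells tends to infinity. -/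
structure BoundaryAssumption {d : ℕ} (S : HilbertScheme d) (b : ℕ) (Ω : Set (Fin d → ℝ)) : Prop where
  lower_bound : ∃ c : ℝ, 0 < c ∧ ∃ N₀ : ℕ, 1 ≤ N₀ ∧ ∀ m : ℕ, N₀ ≤ b ^ m →
    ∀ i ∈ boundaryCells S Ω (b ^ m), c ≤ cellVariance S Ω (b ^ m) i
  tendsto_ncard : Tendsto (fun m : ℕ => (boundaryCells S Ω (b ^ m)).ncard) atTop atTop

end HSFC

namespace HSFC

/-! ### Uniform distributions on finite grids and their limits -/

/-! For `n = b ^ m` the estimate is a stratified sampling estimate in disguise. The first `n`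
scrambled points fall one into each interval of length `1 / n`. Which point falls where is decided
by the permutations of words shorter than `m`. The relative positions inside the intervals are
decided by the permutations of longer words, and no two (point, digit) pairs use the same long word.
Hence the positions are i.i.d. uniform on `[0,1]` and independent of the order. The sum over the
points does not see the order, so it is a sum of independent terms, one per interval
(`exists_stratified`).

The Hilbert curve preserves Lebesgue measure and is injective up to a null set, so a uniform point
of the `k`-th interval is mapped to a uniform point of the `k`-th stratum
(`HilbertScheme.map_curve_affine`). The centred summands are therefore bounded by one and have the
cell variances as variances. The boundary cells alone contribute at least `c` times their number, so
the total variance tends to infinity (`tendsto_sum_cellVariance`).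

For bounded summands this is all that a central limit theorem needs (`tendsto_charFun_of_bounded`):
with total variance `v`, the characteristic function at `t / √v` differs from the Gaussian one by at
most `4 |t| ^ 3 / √v`. The lemma `standardized_estimate_eq` identifies the standardized estimate
with the standardized sum.

Both uniformity claims (curve and digits) come from `map_eq_map_of_uniform_grid`: a law is
determined by its discretizations on finer and finer grids. -/

/-- The masses add up to one, so none of the upper bounds can be strict. One-sided bounds allow grid
cells to be enclosed in closed boxes, whatever happens on their boundaries. -/
theorem measure_singleton_eq_inv_card {ι : Type*} [Fintype ι] [MeasurableSpace ι]
    [MeasurableSingletonClass ι] (μ : Measure ι) [IsProbabilityMeasure μ]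
    (h : ∀ i, μ {i} ≤ (Fintype.card ι : ENNReal)⁻¹) (i : ι) :
    μ {i} = (Fintype.card ι : ENNReal)⁻¹ := by
  have hc : (Fintype.card ι : ENNReal) ≠ 0 := by exact_mod_cast (Fintype.card_pos_iff.2 ⟨i⟩).ne'
  have hr : ∀ j, μ.real {j} ≤ (Fintype.card ι : ℝ)⁻¹ := fun j => by
    have := ENNReal.toReal_mono (ENNReal.inv_ne_top.2 hc) (h j)
    simpa [measureReal_def] using this
  have h1 : ∑ j, ((Fintype.card ι : ℝ)⁻¹ - μ.real {j}) = 0 := by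
    rw [Finset.sum_sub_distrib, sum_measureReal_singleton, Finset.coe_univ, Finset.sum_const,
      Finset.card_univ, nsmul_eq_mul, mul_inv_cancel₀ (by exact_mod_cast hc)]
    simp
  have h2 := (Finset.sum_eq_zero_iff_of_nonneg fun j _ => sub_nonneg.2 (hr j)).1 h1 i
    (Finset.mem_univ i)
  rw [← ENNReal.toReal_eq_toReal_iff' (measure_ne_top _ _) (ENNReal.inv_ne_top.2 hc)]
  simp only [measureReal_def] at h2
  simp only [ENNReal.toReal_inv, ENNReal.toReal_natCast]
  linarith

/-- Dominated convergence, as `c m (K m a)` tends to `X a` almost surely. The left side depends on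
`K m` only through its law. -/
theorem tendsto_integral_of_approximation {A E : Type*} [MeasurableSpace A]
    [PseudoMetricSpace E] [MeasurableSpace E] [BorelSpace E]
    (P : Measure A) [IsProbabilityMeasure P] {X : A → E} (hX : AEMeasurable X P)
    {ι : ℕ → Type*} [∀ m, Finite (ι m)] [∀ m, MeasurableSpace (ι m)]
    [∀ m, MeasurableSingletonClass (ι m)] {K : ∀ m, A → ι m} (hK : ∀ m, Measurable (K m))
    (c : ∀ m, ι m → E) {ε : ℕ → ℝ} (hε : Tendsto ε atTop (𝓝 0))
    (hXK : ∀ᵐ a ∂P, ∀ m, dist (X a) (c m (K m a)) ≤ ε m) (f : BoundedContinuousFunction E ℝ) :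
    Tendsto (fun m => ∫ i, f (c m i) ∂(P.map (K m))) atTop (𝓝 (∫ x, f x ∂(P.map X))) := by
  have hm : ∀ m, Measurable fun i => f (c m i) := fun m => measurable_of_finite _
  rw [integral_map hX f.continuous.aestronglyMeasurable]
  simp_rw [fun m => integral_map (hK m).aemeasurable (hm m).aestronglyMeasurable (μ := P)]
  refine tendsto_integral_of_dominated_convergence (fun _ => ‖f‖)
    (fun m => ((hm m).comp (hK m)).aestronglyMeasurable) (integrable_const _)
    (fun m => Eventually.of_forall fun a => f.norm_coe_le_norm _) ?_
  filter_upwards [hXK] with a ha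
  refine (f.continuous.tendsto (X a)).comp (tendsto_iff_dist_tendsto_zero.2 ?_)
  refine squeeze_zero (fun m => dist_nonneg) (fun m => ?_) hε
  rw [dist_comm]; exact ha m

/-- Two random variables that are uniformly approximated by the same functions of uniform random
variables on finite sets have the same law. -/
theorem map_eq_map_of_uniform_grid {A B E : Type*} [MeasurableSpace A] [MeasurableSpace B]
    [PseudoMetricSpace E] [MeasurableSpace E] [BorelSpace E]
    (P : Measure A) [IsProbabilityMeasure P] (Q : Measure B) [IsProbabilityMeasure Q]
    {X : A → E} {Y : B → E} (hX : AEMeasurable X P) (hY : AEMeasurable Y Q)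
    {ι : ℕ → Type*} [∀ m, Fintype (ι m)] [∀ m, MeasurableSpace (ι m)]
    [∀ m, MeasurableSingletonClass (ι m)] {K : ∀ m, A → ι m} {L : ∀ m, B → ι m}
    (hK : ∀ m, Measurable (K m)) (hL : ∀ m, Measurable (L m))
    (hPK : ∀ m i, P (K m ⁻¹' {i}) ≤ (Fintype.card (ι m) : ENNReal)⁻¹)
    (hQL : ∀ m i, Q (L m ⁻¹' {i}) ≤ (Fintype.card (ι m) : ENNReal)⁻¹)
    (c : ∀ m, ι m → E) {ε : ℕ → ℝ} (hε : Tendsto ε atTop (𝓝 0))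
    (hXK : ∀ᵐ a ∂P, ∀ m, dist (X a) (c m (K m a)) ≤ ε m)
    (hYL : ∀ᵐ y ∂Q, ∀ m, dist (Y y) (c m (L m y)) ≤ ε m) :
    P.map X = Q.map Y := by
  have hPQ : ∀ m, P.map (K m) = Q.map (L m) := fun m => by
    have h1 := Measure.isProbabilityMeasure_map (μ := P) (hK m).aemeasurable
    have h2 := Measure.isProbabilityMeasure_map (μ := Q) (hL m).aemeasurable
    refine Measure.ext_of_singleton fun i => ?_
    rw [measure_singleton_eq_inv_card _ (fun i => ?_), measure_singleton_eq_inv_card _ (fun i => ?_)]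
    · rw [Measure.map_apply (hL m) (measurableSet_singleton i)]; exact hQL m i
    · rw [Measure.map_apply (hK m) (measurableSet_singleton i)]; exact hPK m i
  have h1 := Measure.isProbabilityMeasure_map (μ := P) hX
  have h2 := Measure.isProbabilityMeasure_map (μ := Q) hY
  refine ext_of_forall_integral_eq_of_IsFiniteMeasure fun f => ?_
  refine tendsto_nhds_unique (tendsto_integral_of_approximation P hX hK c hε hXK f) ?_
  simp_rw [hPQ]
  exact tendsto_integral_of_approximation Q hY hL c hε hYL f


/-! ### The Hilbert curve as a measure preserving map -/

theorem measurable_intervalIndex (d m : ℕ) : Measurable (intervalIndex d m) := by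
  unfold intervalIndex
  fun_prop

theorem intervalIndex_le_mul (d m : ℕ) {x : ℝ} (h0 : 0 ≤ x) :
    (intervalIndex d m x : ℝ) ≤ x * 2 ^ (d * m) :=
  (Nat.cast_le.2 (min_le_left _ _)).trans (Nat.floor_le (by positivity))

theorem mul_le_intervalIndex (d m : ℕ) {x : ℝ} (h1 : x ≤ 1) :
    x * 2 ^ (d * m) ≤ intervalIndex d m x + 1 := by
  have hp : 0 < 2 ^ (d * m) := by positivity
  unfold intervalIndex
  rcases min_choice ⌊x * 2 ^ (d * m)⌋₊ (2 ^ (d * m) - 1) with h | h <;> rw [h]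
  · exact (Nat.lt_floor_add_one _).le
  · rw [Nat.cast_sub hp]
    push_cast
    nlinarith [pow_pos (two_pos : (0 : ℝ) < 2) (d * m)]

theorem intervalIndex_mem (d m : ℕ) {x : ℝ} (hx : x ∈ Set.Icc (0 : ℝ) 1) :
    x ∈ Set.Icc ((intervalIndex d m x : ℝ) / 2 ^ (d * m))
      (((intervalIndex d m x : ℝ) + 1) / 2 ^ (d * m)) := by
  have hp : (0 : ℝ) < 2 ^ (d * m) := by positivity
  rw [Set.mem_Icc, div_le_iff₀ hp, le_div_iff₀ hp]
  exact ⟨intervalIndex_le_mul d m hx.1, mul_le_intervalIndex d m hx.2⟩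

theorem intervalIndex_le_succ (d m : ℕ) {x y : ℝ} (h : |x - y| < 1 / 2 ^ (d * m)) :
    intervalIndex d m y ≤ intervalIndex d m x + 1 := by
  have hp : (0 : ℝ) < 2 ^ (d * m) := by positivity
  have h1 : y * 2 ^ (d * m) < x * 2 ^ (d * m) + 1 := by
    rw [lt_div_iff₀ hp] at h
    nlinarith [neg_abs_le (x - y), le_abs_self (x - y)]
  have h2 : ⌊y * 2 ^ (d * m)⌋₊ ≤ ⌊x * 2 ^ (d * m)⌋₊ + 1 := by
    rcases le_or_gt 0 (x * 2 ^ (d * m)) with h0 | h0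
    · rw [← Nat.floor_add_one h0]
      exact Nat.floor_mono h1.le
    -- Natural floors are 0 at negative arguments, so no restriction to `[0,1]` is needed.
    · rw [Nat.floor_eq_zero.2 (by linarith : y * 2 ^ (d * m) < 1)]
      exact Nat.zero_le _
  unfold intervalIndex
  omega

namespace HilbertScheme

variable {d : ℕ} (S : HilbertScheme d)

theorem cell_lt {m k : ℕ} (hk : k < 2 ^ (d * m)) (j : Fin d) : S.cell m k j < 2 ^ m :=
  (S.bijOn m).mapsTo hk j

/-- Such points lie in equal or consecutive intervals, and the cells of consecutive intervals share
a face. -/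
theorem cell_intervalIndex_le (m : ℕ) {x y : ℝ} (h : |x - y| < 1 / 2 ^ (d * m)) (j : Fin d) :
    S.cell m (intervalIndex d m y) j ≤ S.cell m (intervalIndex d m x) j + 1 := by
  have h1 := intervalIndex_le_succ d m h
  rw [abs_sub_comm] at h
  have h2 := intervalIndex_le_succ d m h
  have hx := intervalIndex_lt d m x
  have hy := intervalIndex_lt d m y
  have key : ∀ k, k + 1 < 2 ^ (d * m) → S.cell m k j ≤ S.cell m (k + 1) j + 1 ∧
      S.cell m (k + 1) j ≤ S.cell m k j + 1 := fun k hk => by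
    obtain ⟨i, hi, hl⟩ := S.adjacent m k hk
    by_cases hj : j = i
    · subst hj; omega
    · rw [hl j hj]; omega
  rcases (by omega : intervalIndex d m y = intervalIndex d m x ∨
    intervalIndex d m y = intervalIndex d m x + 1 ∨
    intervalIndex d m x = intervalIndex d m y + 1) with e | e | e
  · rw [e]; omega
  · rw [e]; exact (key _ (by omega)).2
  · rw [e]; exact (key _ (by omega)).1

/-- Parameters closer than `2 ^ (-d m)` have equal or adjacent cells of side `2 ^ (-m)`, so their
images differ by at most `2 * 2 ^ (-m)` in each coordinate. The clamped index makes this work on the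
whole line. -/
theorem continuous_curve : Continuous S.curve := by
  rw [Metric.continuous_iff]
  intro x ε hε
  obtain ⟨m, hm⟩ := exists_pow_lt_of_lt_one (half_pos hε) (by norm_num : (1 / 2 : ℝ) < 1)
  refine ⟨1 / 2 ^ (d * m), by positivity, fun y hy => ?_⟩
  rw [dist_pi_lt_iff hε]
  intro j
  rw [Real.dist_eq] at hy ⊢
  have hp : (0 : ℝ) < 2 ^ m := by positivity
  have hx1 := S.curve_mem m x j
  have hy1 := S.curve_mem m y j
  have a1 : (S.cell m (intervalIndex d m x) j : ℝ) ≤ S.cell m (intervalIndex d m y) j + 1 := by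
    exact_mod_cast S.cell_intervalIndex_le m hy j
  rw [abs_sub_comm] at hy
  have a2 : (S.cell m (intervalIndex d m y) j : ℝ) ≤ S.cell m (intervalIndex d m x) j + 1 := by
    exact_mod_cast S.cell_intervalIndex_le m hy j
  rw [one_div_pow, div_lt_iff₀ hp] at hm
  rw [Set.mem_Icc, div_le_iff₀ hp, le_div_iff₀ hp] at hx1 hy1
  have : |(S.curve y j - S.curve x j) * 2 ^ m| ≤ 2 := by
    rw [abs_le]; constructor <;> nlinarith
  rw [abs_mul, abs_of_pos hp] at this
  nlinarith

theorem curve_mem_cube (x : ℝ) : S.curve x ∈ Set.Icc (0 : Fin d → ℝ) 1 := by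
  have h : ∀ j, S.curve x j ∈ Set.Icc (0 : ℝ) 1 := fun j => by
    have h0 := S.cell_lt (intervalIndex_lt d 0 x) j
    rw [pow_zero, Nat.lt_one_iff] at h0
    simpa [h0] using S.curve_mem 0 x j
  exact ⟨fun j => (h j).1, fun j => (h j).2⟩

end HilbertScheme

instance isProbabilityMeasure_unitInterval :
    IsProbabilityMeasure (volume.restrict (Set.Icc (0 : ℝ) 1)) :=
  ⟨by simp⟩

instance isProbabilityMeasure_unitCube (d : ℕ) :
    IsProbabilityMeasure (volume.restrict (Set.Icc (0 : Fin d → ℝ) 1)) :=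
  ⟨by simp [Real.volume_Icc_pi]⟩

theorem card_grid (d m : ℕ) : (Fintype.card (Fin d → Fin (2 ^ m)) : ENNReal) = 2 ^ (d * m) := by
  simp [pow_mul, mul_comm d m]

theorem ofReal_inv_two_pow (k : ℕ) : ENNReal.ofReal (1 / 2 ^ k) = (2 ^ k : ENNReal)⁻¹ := by
  rw [one_div, ENNReal.ofReal_inv_of_pos (by positivity), ENNReal.ofReal_pow (by norm_num)]
  simp

/-- The Hilbert curve maps Lebesgue measure on `[0,1]` to Lebesgue measure on `[0,1]^d`. -/
theorem HilbertScheme.map_curve {d : ℕ} (S : HilbertScheme d) :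
    (volume.restrict (Set.Icc (0 : ℝ) 1)).map S.curve =
      volume.restrict (Set.Icc (0 : Fin d → ℝ) 1) := by
  have hval : ∀ m k, k < 2 ^ (d * m) → ∀ j,
      ((Fin.ofNat (2 ^ m) (S.cell m k j) : Fin (2 ^ m)) : ℕ) = S.cell m k j :=
    fun m k hk j => by simpa using Nat.mod_eq_of_lt (S.cell_lt hk j)
  have hval' : ∀ m (x : ℝ), ((Fin.ofNat (2 ^ m) (intervalIndex 1 m x) : Fin (2 ^ m)) : ℕ) =
      intervalIndex 1 m x :=
    fun m x => by simpa using Nat.mod_eq_of_lt (by simpa using intervalIndex_lt 1 m x)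
  -- The common grid consists of the cell indices `κ` of level `m`: `K` is the cell assigned to a
  -- parameter, `L` the cell that contains a point of the cube, read off coordinatewise by
  -- `intervalIndex 1`. The lower corner `κ / 2 ^ m` approximates both within `2 ^ (-m)`.
  rw [map_eq_map_of_uniform_grid (volume.restrict (Set.Icc (0 : ℝ) 1))
    (volume.restrict (Set.Icc (0 : Fin d → ℝ) 1)) S.continuous_curve.aemeasurable (Y := id)
    aemeasurable_id (ι := fun m => Fin d → Fin (2 ^ m))
    (K := fun m x => (fun k j => Fin.ofNat (2 ^ m) (S.cell m k j)) (intervalIndex d m x))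
    (L := fun m y j => Fin.ofNat (2 ^ m) (intervalIndex 1 m (y j)))
    (fun m => (measurable_from_nat (f := fun k j => Fin.ofNat (2 ^ m) (S.cell m k j))).comp
      (measurable_intervalIndex d m))
    (fun m => measurable_pi_iff.2 fun j =>
      (measurable_from_nat (f := fun k => Fin.ofNat (2 ^ m) k)).comp ((measurable_intervalIndex 1 m).comp (measurable_pi_apply j)))
    ?_ ?_ (fun m κ j => (κ j : ℝ) / 2 ^ m) (ε := fun m => 1 / 2 ^ m) ?_ ?_ ?_, Measure.map_id]
  · intro m κ
    rw [card_grid, Measure.restrict_apply' measurableSet_Icc]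
    -- By injectivity of `cell m`, the preimage of an attained cell lies in one interval of length
    -- `2 ^ (-d m)`; otherwise the preimage is empty.
    by_cases hne : ∃ x, (fun j => Fin.ofNat (2 ^ m) (S.cell m (intervalIndex d m x) j)) = κ
    · obtain ⟨x, rfl⟩ := hne
      refine (measure_mono (t := Set.Icc ((intervalIndex d m x : ℝ) / 2 ^ (d * m))
        (((intervalIndex d m x : ℝ) + 1) / 2 ^ (d * m))) ?_).trans ?_
      · rintro y ⟨hy, hy1⟩
        have : intervalIndex d m y = intervalIndex d m x := by
          refine (S.bijOn m).injOn (intervalIndex_lt d m y) (intervalIndex_lt d m x) ?_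
          funext j
          rw [← hval m _ (intervalIndex_lt d m y), ← hval m _ (intervalIndex_lt d m x)]
          exact congrArg Fin.val (congrFun hy j)
        rw [← this]
        exact intervalIndex_mem d m hy1
      · rw [Real.volume_Icc, ← ofReal_inv_two_pow]
        apply le_of_eq; congr 1; ring
    · rw [show (_ ⁻¹' {κ} : Set ℝ) = ∅ from Set.eq_empty_of_forall_notMem fun x hx => hne ⟨x, hx⟩]
      simp
  · intro m κ
    rw [card_grid, Measure.restrict_apply' measurableSet_Icc]
    refine (measure_mono (t := Set.Icc (fun j => (κ j : ℝ) / 2 ^ m)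
      (fun j => ((κ j : ℝ) + 1) / 2 ^ m)) ?_).trans ?_
    · rintro y ⟨rfl, hy⟩
      have h : ∀ j, _ := fun j => intervalIndex_mem 1 m (x := y j) ⟨hy.1 j, hy.2 j⟩
      simp only [one_mul] at h
      refine ⟨fun j => ?_, fun j => ?_⟩
      · simpa only [hval'] using (h j).1
      · simpa only [hval'] using (h j).2
    · rw [Real.volume_Icc_pi]
      have : ∀ j, ENNReal.ofReal (((κ j : ℝ) + 1) / 2 ^ m - (κ j : ℝ) / 2 ^ m) =
          (2 ^ m : ENNReal)⁻¹ := fun j => by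
        rw [← ofReal_inv_two_pow]; congr 1; ring
      simp only [this, Finset.prod_const, Finset.card_univ, Fintype.card_fin]
      rw [← ENNReal.inv_pow, ← pow_mul, mul_comm m d]
  · simpa using tendsto_pow_atTop_nhds_zero_of_lt_one (r := (1 / 2 : ℝ)) (by norm_num) (by norm_num)
  · refine Eventually.of_forall fun x m => (dist_pi_le_iff (by positivity)).2 fun j => ?_
    have h := S.curve_mem m x j
    rw [Real.dist_eq, hval m _ (intervalIndex_lt d m x), abs_le]
    have e := add_div (S.cell m (intervalIndex d m x) j : ℝ) 1 (2 ^ m)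
    have : (0 : ℝ) ≤ 1 / 2 ^ m := by positivity
    constructor <;> linarith [h.1, h.2]
  · refine (ae_restrict_mem measurableSet_Icc).mono fun y hy m =>
      (dist_pi_le_iff (by positivity)).2 fun j => ?_
    have h := intervalIndex_mem 1 m (x := y j) ⟨hy.1 j, hy.2 j⟩
    simp only [one_mul] at h
    rw [Real.dist_eq, hval', abs_le]
    have e := add_div (intervalIndex 1 m (y j) : ℝ) 1 (2 ^ m)
    have : (0 : ℝ) ≤ 1 / 2 ^ m := by positivity
    simp only [id]
    constructor <;> linarith [h.1, h.2]


/-! ### Essential injectivity of the Hilbert curve and the uniform law on a stratum -/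

/-- The union of all dyadic hyperplanes `y j = a / 2 ^ m`. -/
def dyadicHyperplanes (d : ℕ) : Set (Fin d → ℝ) :=
  {y | ∃ (j : Fin d) (m a : ℕ), y j = (a : ℝ) / 2 ^ m}

theorem volume_dyadicHyperplanes (d : ℕ) : volume (dyadicHyperplanes d) = 0 := by
  have : dyadicHyperplanes d =
      ⋃ j : Fin d, ⋃ m : ℕ, ⋃ a : ℕ, {y : Fin d → ℝ | y j = (a : ℝ) / 2 ^ m} := by
    ext y
    simp [dyadicHyperplanes]
  rw [this]
  exact measure_iUnion_null fun j => measure_iUnion_null fun m => measure_iUnion_null fun a =>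
    Measure.pi_hyperplane (fun _ => (volume : Measure ℝ)) j _

namespace HilbertScheme

variable {d : ℕ} (S : HilbertScheme d)

/-- At a fine enough level the two parameters belong to different cells, and the common image lies
in both. Two different dyadic cubes of one level meet only in their boundaries. -/
theorem curve_mem_dyadicHyperplanes (hd : 1 ≤ d) {x y : ℝ} (hx : x ∈ Set.Icc (0 : ℝ) 1)
    (hy : y ∈ Set.Icc (0 : ℝ) 1) (hne : x ≠ y) (h : S.curve x = S.curve y) :
    S.curve x ∈ dyadicHyperplanes d := by
  obtain ⟨m, hm⟩ := exists_pow_lt_of_lt_one (abs_pos.2 (sub_ne_zero.2 hne))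
    (by norm_num : (1 / 2 : ℝ) < 1)
  -- Here `1 ≤ d` enters: for `d = 0` the intervals would not shrink.
  have hm' : 1 / 2 ^ (d * m) < |x - y| := by
    refine lt_of_le_of_lt ?_ hm
    rw [← one_div_pow]
    exact pow_le_pow_of_le_one (by norm_num) (by norm_num) (Nat.le_mul_of_pos_left m hd)
  have hidx : intervalIndex d m x ≠ intervalIndex d m y := fun e => by
    have h1 := intervalIndex_mem d m hx
    have h2 := intervalIndex_mem d m hy
    rw [← e] at h2
    rw [add_div] at h1 h2
    refine absurd hm' (not_lt.2 (abs_le.2 ⟨?_, ?_⟩)) <;> linarith [h1.1, h1.2, h2.1, h2.2]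
  have hcell : S.cell m (intervalIndex d m x) ≠ S.cell m (intervalIndex d m y) := fun e =>
    hidx ((S.bijOn m).injOn (intervalIndex_lt d m x) (intervalIndex_lt d m y) e)
  obtain ⟨j, hj⟩ := Function.ne_iff.1 hcell
  have hp : (0 : ℝ) < 2 ^ m := by positivity
  have h1 := S.curve_mem m x j
  have h2 := S.curve_mem m y j
  rw [← h] at h2
  rw [Set.mem_Icc, div_le_iff₀ hp, le_div_iff₀ hp] at h1 h2
  -- The upper face of the lower cell and the lower face of the higher cell must coincide, at the
  -- larger index.
  refine ⟨j, m, max (S.cell m (intervalIndex d m x) j) (S.cell m (intervalIndex d m y) j), ?_⟩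
  rw [eq_div_iff hp.ne']
  rcases lt_or_gt_of_ne hj with hlt | hlt
  · have : (S.cell m (intervalIndex d m x) j : ℝ) + 1 ≤ S.cell m (intervalIndex d m y) j := by
      exact_mod_cast hlt
    rw [max_eq_right hlt.le]
    linarith [h1.2, h2.1]
  · have : (S.cell m (intervalIndex d m y) j : ℝ) + 1 ≤ S.cell m (intervalIndex d m x) j := by
      exact_mod_cast hlt
    rw [max_eq_left hlt.le]
    linarith [h2.2, h1.1]

/-- Within `[0,1]`, the preimage of `S.curve '' I` exceeds `I` only by parameters mapped into dyadic
hyperplanes. These form a null set because the curve preserves measure. Compactness makes the image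
measurable. -/
theorem map_curve_restrict (hd : 1 ≤ d) {I : Set ℝ} (hI : I ⊆ Set.Icc 0 1) (hc : IsCompact I) :
    (volume.restrict I).map S.curve = volume.restrict (S.curve '' I) := by
  have hE : MeasurableSet (S.curve '' I) := (hc.image S.continuous_curve).measurableSet
  refine Measure.ext fun B hB => ?_
  have hcube : S.curve '' I ⊆ Set.Icc (0 : Fin d → ℝ) 1 := by
    rintro _ ⟨x, -, rfl⟩; exact S.curve_mem_cube x
  have e1 : volume (B ∩ S.curve '' I) =
      (volume.restrict (Set.Icc (0 : Fin d → ℝ) 1)) (B ∩ S.curve '' I) := by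
    rw [Measure.restrict_apply (hB.inter hE), Set.inter_eq_left.2
      (Set.inter_subset_right.trans hcube)]
  have hm := S.continuous_curve.measurable
  rw [Measure.map_apply hm hB, Measure.restrict_apply (hm hB), Measure.restrict_apply hB, e1,
    ← S.map_curve, Measure.map_apply hm (hB.inter hE), Measure.restrict_apply (hm (hB.inter hE))]
  refine le_antisymm (measure_mono fun x hx => ⟨⟨hx.1, x, hx.2, rfl⟩, hI hx.2⟩) ?_
  have hnull : volume (S.curve ⁻¹' dyadicHyperplanes d ∩ Set.Icc 0 1) = 0 := by
    rw [← Measure.restrict_apply' measurableSet_Icc]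
    have : (volume.restrict (Set.Icc (0 : ℝ) 1)).map S.curve (dyadicHyperplanes d) = 0 := by
      rw [S.map_curve]
      exact Measure.absolutelyContinuous_of_le Measure.restrict_le_self (volume_dyadicHyperplanes d)
    exact Measure.preimage_null_of_map_null hm.aemeasurable this
  refine (measure_mono (t := (S.curve ⁻¹' B ∩ I) ∪
    (S.curve ⁻¹' dyadicHyperplanes d ∩ Set.Icc 0 1)) ?_).trans
    ((measure_union_le _ _).trans (by rw [hnull, add_zero]))
  rintro x ⟨⟨hxB, y, hyI, hyx⟩, hx⟩
  by_cases hxy : x = y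
  · exact Or.inl ⟨hxB, hxy ▸ hyI⟩
  · exact Or.inr ⟨S.curve_mem_dyadicHyperplanes hd hx (hI hyI) hxy hyx.symm, hx⟩

end HilbertScheme

theorem subinterval_subset {n k : ℕ} (hk : k < n) :
    Set.Icc ((k : ℝ) / n) (((k : ℝ) + 1) / n) ⊆ Set.Icc 0 1 := by
  have hn : (0 : ℝ) < n := by exact_mod_cast (Nat.zero_le k).trans_lt hk
  refine Set.Icc_subset_Icc (by positivity) ((div_le_one hn).2 ?_)
  exact_mod_cast hk

theorem map_affine_volume {n : ℕ} (hn : 0 < n) (k : ℕ) :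
    (volume.restrict (Set.Icc (0 : ℝ) 1)).map (fun u => ((k : ℝ) + u) / n) =
      (n : ENNReal) • volume.restrict (Set.Icc ((k : ℝ) / n) (((k : ℝ) + 1) / n)) := by
  have hn' : (0 : ℝ) < n := by exact_mod_cast hn
  have hpre : (fun u : ℝ => ((k : ℝ) + u) / n) ⁻¹' Set.Icc ((k : ℝ) / n) (((k : ℝ) + 1) / n) =
      Set.Icc 0 1 := by
    ext u
    simp only [Set.mem_preimage, Set.mem_Icc, div_le_div_iff_of_pos_right hn']
    constructor <;> rintro ⟨h1, h2⟩ <;> constructor <;> linarith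
  have hf : Measurable fun u : ℝ => ((k : ℝ) + u) / n := by fun_prop
  have hvol : (volume : Measure ℝ).map (fun u => ((k : ℝ) + u) / n) =
      (n : ENNReal) • volume := by
    have : (fun u : ℝ => ((k : ℝ) + u) / n) = (fun u => u * (n : ℝ)⁻¹) ∘ fun u => (k : ℝ) + u := by
      funext u; simp [div_eq_mul_inv]
    rw [this, ← Measure.map_map (by fun_prop) (by fun_prop), map_add_left_eq_self,
      Real.map_volume_mul_right (inv_ne_zero hn'.ne'), inv_inv, abs_of_pos hn',
      ENNReal.ofReal_natCast]
  rw [← Measure.restrict_smul, ← hvol, Measure.restrict_map hf measurableSet_Icc, hpre]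

/-- The image under the Hilbert curve of a uniform point of the `k`-th interval of length `1 / n` is
uniformly distributed on the `k`-th stratum. -/
theorem HilbertScheme.map_curve_affine {d : ℕ} (S : HilbertScheme d) (hd : 1 ≤ d) {n k : ℕ}
    (hk : k < n) :
    (volume.restrict (Set.Icc (0 : ℝ) 1)).map (fun u => S.curve (((k : ℝ) + u) / n)) =
      cond volume (stratum S n k) := by
  have hn : 0 < n := (Nat.zero_le k).trans_lt hk
  have hn' : (0 : ℝ) < n := by exact_mod_cast hn
  have hr := S.map_curve_restrict hd (subinterval_subset hk) isCompact_Icc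
  -- The normalizing factor of `cond` is thus the factor `n` produced by rescaling the interval.
  have hvol : volume (stratum S n k) = (n : ENNReal)⁻¹ := by
    have := congrArg (fun ν => ν Set.univ) hr
    simp only [Measure.map_apply S.continuous_curve.measurable MeasurableSet.univ,
      Set.preimage_univ, Measure.restrict_apply_univ, Real.volume_Icc] at this
    rw [stratum, ← this, ← sub_div, add_sub_cancel_left, one_div, ENNReal.ofReal_inv_of_pos hn',
      ENNReal.ofReal_natCast]
  have hcomp : (fun u : ℝ => S.curve (((k : ℝ) + u) / n)) =
      S.curve ∘ fun u => ((k : ℝ) + u) / n := rfl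
  rw [hcomp, ← Measure.map_map S.continuous_curve.measurable (by fun_prop), map_affine_volume hn,
    Measure.map_smul, hr, ProbabilityTheory.cond, hvol, inv_inv]
  rfl

/-- Substitution, then additivity over adjacent intervals. This is the source of the unbiasedness of
the estimate. -/
theorem sum_integral_affine {h : ℝ → ℝ} (hh : IntegrableOn h (Set.Icc 0 1)) {n : ℕ} (hn : 0 < n) :
    ∑ k : Fin n, ∫ u in Set.Icc (0 : ℝ) 1, h (((k : ℝ) + u) / n) =
      n * ∫ u in Set.Icc (0 : ℝ) 1, h u := by
  have hn' : (0 : ℝ) < n := by exact_mod_cast hn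
  have e : ∀ k : ℕ, ∫ u in Set.Icc (0 : ℝ) 1, h (((k : ℝ) + u) / n) =
      n * ∫ u in ((k : ℕ) : ℝ) / n..((k + 1 : ℕ) : ℝ) / n, h u := fun k => by
    rw [integral_Icc_eq_integral_Ioc, ← intervalIntegral.integral_of_le zero_le_one]
    have := intervalIntegral.integral_comp_div_add (a := 0) (b := 1) h hn'.ne' ((k : ℝ) / n)
    rw [smul_eq_mul, zero_div, zero_add, ← add_div, add_comm (1 : ℝ)] at this
    rw [Nat.cast_succ, ← this]
    refine intervalIntegral.integral_congr fun u _ => ?_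
    simp only [← add_div, add_comm]
  rw [Fin.sum_univ_eq_sum_range (fun k => ∫ u in Set.Icc (0 : ℝ) 1, h (((k : ℝ) + u) / n)),
    Finset.sum_congr rfl fun k _ => e k, ← Finset.mul_sum,
    intervalIntegral.sum_integral_adjacent_intervals, Nat.cast_zero, zero_div, div_self hn'.ne',
    intervalIntegral.integral_of_le zero_le_one, integral_Icc_eq_integral_Ioc]
  intro k hk
  rw [intervalIntegrable_iff_integrableOn_Icc_of_le (by gcongr; simp)]
  refine hh.mono_set ?_
  simpa using subinterval_subset hk


/-! ### The uniform law of a real number with independent uniform digits -/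

theorem ofDigits_mem_Icc {b : ℕ} (a : ℕ → Fin b) (M : ℕ) :
    Real.ofDigits a ∈ Set.Icc (∑ i ∈ Finset.range M, Real.ofDigitsTerm a i)
      ((∑ i ∈ Finset.range M, Real.ofDigitsTerm a i) + ((b : ℝ) ^ M)⁻¹) := by
  have hb : (0 : ℝ) ≤ ((b : ℝ) ^ M)⁻¹ := by positivity
  have h0 := Real.ofDigits_nonneg fun i => a (i + M)
  have h1 := Real.ofDigits_le_one fun i => a (i + M)
  rw [Real.ofDigits_eq_sum_add_ofDigits a M]
  constructor <;> nlinarith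

/-- The digit sequence that starts with `e` and continues with zeros. -/
def extendDigits {b : ℕ} [NeZero b] {M : ℕ} (e : Fin M → Fin b) (j : ℕ) : Fin b :=
  if h : j < M then e ⟨j, h⟩ else 0

theorem extendDigits_of_eq {b : ℕ} [NeZero b] {M : ℕ} {a : ℕ → Fin b} {j : ℕ} (hj : j < M) :
    a j = extendDigits (fun l : Fin M => a l) j := by
  simp [extendDigits, hj]

theorem card_digits (b M : ℕ) : (Fintype.card (Fin M → Fin b) : ENNReal) = (b : ENNReal) ^ M := by
  simp

/-- The first `M` random digits and the first `M` digits of a uniform number are both uniform on the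
words of length `M`, and `M` digits determine a number up to `b ^ (-M)`. -/
theorem map_ofDigits_eq_uniform {A : Type*} [MeasurableSpace A] (P : Measure A)
    [IsProbabilityMeasure P] {b : ℕ} [NeZero b] (hb : 2 ≤ b) {D : ℕ → A → Fin b}
    (hD : ∀ j, Measurable (D j)) (hi : iIndepFun D P)
    (hu : ∀ j e, P (D j ⁻¹' {e}) = (b : ENNReal)⁻¹) :
    P.map (fun a => Real.ofDigits fun j => D j a) = volume.restrict (Set.Icc (0 : ℝ) 1) := by
  have hb0 : (0 : ℝ) < b := by exact_mod_cast (by omega : 0 < b)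
  -- The endpoint 1 is discarded: `Real.ofDigits_digits` recovers a number from its digits on
  -- `[0,1)`.
  have hIco : ∀ᵐ y ∂(volume.restrict (Set.Icc (0 : ℝ) 1)), y ∈ Set.Ico (0 : ℝ) 1 := by
    rw [← restrict_Ico_eq_restrict_Icc]
    exact ae_restrict_mem measurableSet_Ico
  have hdig : ∀ j, Measurable fun y : ℝ => Real.digits y b j := fun j =>
    (measurable_from_nat (f := fun k => Fin.ofNat b k)).comp
      (Nat.measurable_floor.comp (measurable_id.mul_const ((b : ℝ) ^ (j + 1))))
  have hm : Measurable fun a => Real.ofDigits fun j => D j a :=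
    Real.continuous_ofDigits.measurable.comp (measurable_pi_iff.2 hD)
  rw [map_eq_map_of_uniform_grid P (volume.restrict (Set.Icc (0 : ℝ) 1)) hm.aemeasurable (Y := id)
    aemeasurable_id (ι := fun M => Fin M → Fin b)
    (K := fun M a j => D j a) (L := fun M y j => Real.digits y b j)
    (fun M => measurable_pi_iff.2 fun j => hD j)
    (fun M => measurable_pi_iff.2 fun j => hdig j) ?_ ?_ (fun M e => Real.ofDigits (extendDigits e))
    (ε := fun M => ((b : ℝ) ^ M)⁻¹) ?_ ?_ ?_, Measure.map_id]
  · intro M e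
    rw [card_digits]
    have : (fun a (j : Fin M) => D j a) ⁻¹' {e} =
        ⋂ j ∈ Finset.univ, (fun j : Fin M => D j) j ⁻¹' {e j} := by
      ext a; simp [funext_iff]
    have hi' : iIndepFun (fun j : Fin M => D j) P := hi.precomp Fin.val_injective
    rw [this, hi'.measure_inter_preimage_eq_mul _ fun j _ => measurableSet_singleton _]
    simp [hu, ENNReal.inv_pow]
  · intro M e
    have hsub : ∀ᵐ y ∂(volume.restrict (Set.Icc (0 : ℝ) 1)),
        y ∈ (fun y (j : Fin M) => Real.digits y b j) ⁻¹' {e} →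
        y ∈ Set.Icc (∑ i ∈ Finset.range M, Real.ofDigitsTerm (extendDigits e) i)
          ((∑ i ∈ Finset.range M, Real.ofDigitsTerm (extendDigits e) i) + ((b : ℝ) ^ M)⁻¹) := by
      filter_upwards [hIco] with y hy hye
      have h := ofDigits_mem_Icc (Real.digits y b) M
      rw [Real.ofDigits_digits (by omega) hy] at h
      have hs : ∑ i ∈ Finset.range M, Real.ofDigitsTerm (Real.digits y b) i =
          ∑ i ∈ Finset.range M, Real.ofDigitsTerm (extendDigits e) i := by
        refine Finset.sum_congr rfl fun i hi => ?_
        have hye' : (fun j : Fin M => Real.digits y b j) = e := hye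
        rw [← hye', Real.ofDigitsTerm, Real.ofDigitsTerm,
          ← extendDigits_of_eq (a := Real.digits y b) (Finset.mem_range.1 hi)]
      rwa [hs] at h
    refine (measure_mono_ae (t := Set.Icc _ _) hsub).trans ((Measure.restrict_apply_le _ _).trans ?_)
    rw [Real.volume_Icc, add_sub_cancel_left, card_digits, ENNReal.ofReal_inv_of_pos (by positivity),
      ENNReal.ofReal_pow hb0.le, ENNReal.ofReal_natCast]
  · have h1 : (b : ℝ)⁻¹ < 1 := inv_lt_one_of_one_lt₀ (by exact_mod_cast (by omega : 1 < b))
    simpa using tendsto_pow_atTop_nhds_zero_of_lt_one (by positivity) h1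
  · exact Eventually.of_forall fun a M => Real.abs_ofDigits_sub_ofDigits_le fun j hj =>
      extendDigits_of_eq (a := fun j => D j a) hj
  · filter_upwards [hIco] with y hy M
    have := Real.abs_ofDigits_sub_ofDigits_le (n := M) fun j hj =>
      extendDigits_of_eq (a := Real.digits y b) (j := j) hj
    rwa [Real.ofDigits_digits (by omega) hy] at this

/-! ### Independence of rows, and random relabelling -/

/-- The joint law is a product over all pairs, and currying turns it into a product of the row laws,
themselves products. -/
theorem iIndepFun_curry {A : Type*} [MeasurableSpace A] {P : Measure A} [IsProbabilityMeasure P]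
    {ι κ E : Type*} [MeasurableSpace E] {X : ι → κ → A → E} (hX : ∀ i j, Measurable (X i j))
    (h : iIndepFun (fun (p : (_ : ι) × κ) => X p.1 p.2) P) :
    iIndepFun (fun i a j => X i j a) P := by
  have hp : ∀ i j, IsProbabilityMeasure (P.map (X i j)) :=
    fun i j => Measure.isProbabilityMeasure_map (hX i j).aemeasurable
  rw [iIndepFun_iff_map_fun_eq_infinitePi_map fun i => measurable_pi_iff.2 fun j => hX i j]
  have hrow : ∀ i, P.map (fun a j => X i j a) = Measure.infinitePi fun j => P.map (X i j) :=
    fun i => (h.precomp (sigma_mk_injective (i := i))).map_fun_eq_infinitePi_map fun j => hX i j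
  have hall : P.map (fun a (p : (_ : ι) × κ) => X p.1 p.2 a) =
      Measure.infinitePi fun p => P.map (X p.1 p.2) :=
    h.map_fun_eq_infinitePi_map fun p => hX p.1 p.2
  simp_rw [hrow]
  have hm : Measurable fun a (p : (_ : ι) × κ) => X p.1 p.2 a :=
    measurable_pi_iff.2 fun p => hX p.1 p.2
  rw [← Measure.infinitePi_map_piCurry (fun i j => P.map (X i j)), ← hall]
  exact (Measure.map_map (MeasurableEquiv.piCurry fun _ _ => E).measurable hm).symm

theorem map_comp_perm {A : Type*} [MeasurableSpace A] {P : Measure A}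
    [IsProbabilityMeasure P] {ι E : Type*} [Fintype ι] [MeasurableSpace E] {ν : Measure E}
    [IsProbabilityMeasure ν] {U : ι → A → E} (hU : ∀ i, Measurable (U i)) (hi : iIndepFun U P)
    (hν : ∀ i, P.map (U i) = ν) (τ : Equiv.Perm ι) :
    P.map (fun a k => U (τ k) a) = Measure.pi fun _ => ν := by
  have := (iIndepFun_iff_map_fun_eq_pi_map fun i => (hU (τ i)).aemeasurable).1
    (hi.precomp τ.injective)
  simpa [hν] using this

/-- A random relabelling of independent identically distributed random variables by an independent
random permutation does not change their joint law. -/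
theorem map_relabel {A : Type*} [MeasurableSpace A] {P : Measure A}
    [IsProbabilityMeasure P] {ι E : Type*} [Fintype ι] [MeasurableSpace E] {ν : Measure E}
    [IsProbabilityMeasure ν] {U : ι → A → E} (hU : ∀ i, Measurable (U i)) (hi : iIndepFun U P)
    (hν : ∀ i, P.map (U i) = ν) {σ : A → Equiv.Perm ι} (hσ : ∀ τ, MeasurableSet {a | σ a = τ})
    (hind : ∀ τ (B : Set (ι → E)), MeasurableSet B →
      P ({a | σ a = τ} ∩ (fun a i => U i a) ⁻¹' B) =
        P {a | σ a = τ} * P ((fun a i => U i a) ⁻¹' B)) :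
    Measurable (fun a k => U (σ a k) a) ∧
      P.map (fun a k => U (σ a k) a) = Measure.pi fun _ => ν := by
  have hτm : ∀ τ : Equiv.Perm ι, Measurable fun (v : ι → E) k => v (τ k) := fun τ => by fun_prop
  have hUm : Measurable fun a i => U i a := measurable_pi_iff.2 hU
  -- On each event `σ = τ` the relabelling is deterministic, and a fixed permutation preserves the
  -- product law.
  have hset : ∀ B : Set (ι → E), (fun a k => U (σ a k) a) ⁻¹' B =
      ⋃ τ : Equiv.Perm ι, {a | σ a = τ} ∩
        (fun a i => U i a) ⁻¹' ((fun v k => v (τ k)) ⁻¹' B) := fun B => by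
    ext a
    simp
  have hm : Measurable (fun a k => U (σ a k) a) := fun B hB => by
    rw [hset]
    exact MeasurableSet.iUnion fun τ => (hσ τ).inter (hUm (hτm τ hB))
  refine ⟨hm, Measure.ext fun B hB => ?_⟩
  have hdisj : Pairwise (Function.onFun Disjoint fun τ : Equiv.Perm ι => {a | σ a = τ}) :=
    fun τ τ' hne => Set.disjoint_left.2 fun a h h' => hne (h.symm.trans h')
  have htot : ∑' τ : Equiv.Perm ι, P {a | σ a = τ} = 1 := by
    rw [← measure_iUnion hdisj hσ, ← measure_univ (μ := P)]
    congr 1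
    ext a; simp
  rw [Measure.map_apply hm hB, hset, measure_iUnion
    (fun τ τ' hne => (hdisj hne).mono Set.inter_subset_left Set.inter_subset_left)
    fun τ => (hσ τ).inter (hUm (hτm τ hB))]
  have e : ∀ τ : Equiv.Perm ι, P ({a | σ a = τ} ∩
      (fun a i => U i a) ⁻¹' ((fun v k => v (τ k)) ⁻¹' B)) =
      P {a | σ a = τ} * Measure.pi (fun _ => ν) B := fun τ => by
    rw [hind τ _ (hτm τ hB), ← map_comp_perm hU hi hν τ,
      Measure.map_apply (measurable_pi_iff.2 fun k => hU (τ k)) hB]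
    rfl
  simp_rw [e]
  rw [ENNReal.tsum_mul_right, htot, one_mul]


/-! ### The stratified structure of the scrambled van der Corput sequence -/

/-- Composition with a transposition matches the permutations with `σ c = e'` to those with `σ c =
e`, so the `b` fibres have equal size. Hence a uniform permutation yields a uniform digit. -/
theorem card_perm_apply_eq {b : ℕ} (c e : Fin b) :
    b * (Finset.univ.filter fun σ : Equiv.Perm (Fin b) => σ c = e).card = b.factorial := by
  have h : ∀ e', (Finset.univ.filter fun σ : Equiv.Perm (Fin b) => σ c = e').card =
      (Finset.univ.filter fun σ : Equiv.Perm (Fin b) => σ c = e).card := fun e' => by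
    refine Finset.card_bij (fun σ _ => Equiv.swap e' e * σ) ?_ ?_ ?_
    · intro σ hσ
      simp only [Finset.mem_filter, Finset.mem_univ, true_and] at hσ ⊢
      simp [hσ]
    · intro σ _ τ _ hστ
      exact mul_left_cancel hστ
    · intro σ hσ
      simp only [Finset.mem_filter, Finset.mem_univ, true_and] at hσ ⊢
      exact ⟨Equiv.swap e' e * σ, by simp [hσ], by simp [← mul_assoc]⟩
  have := Finset.card_eq_sum_card_fiberwise (s := (Finset.univ : Finset (Equiv.Perm (Fin b))))
    (t := Finset.univ) (f := fun σ => σ c) (fun _ _ => Finset.mem_coe.2 (Finset.mem_univ _))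
  rw [Finset.card_univ, Fintype.card_perm, Fintype.card_fin, Finset.sum_congr rfl fun e' _ => h e',
    Finset.sum_const, Finset.card_univ, Fintype.card_fin, smul_eq_mul] at this
  exact this.symm

namespace IsNestedUniformScrambling

variable {b : ℕ} {Ω' : Type*} [MeasurableSpace Ω'] {P : Measure Ω'}
  {π : List (Fin b) → Ω' → Equiv.Perm (Fin b)}

theorem measurable_perm (hπ : IsNestedUniformScrambling P π) (w : List (Fin b)) :
    Measurable[_, ⊤] (π w) :=
  @measurable_to_countable' _ _ ⊤ _ _ _ fun σ => hπ.measurableSet_eq w σ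

theorem measurable_digit (hπ : IsNestedUniformScrambling P π) (w : List (Fin b)) (c : Fin b) :
    Measurable fun ω => π w ω c :=
  (@measurable_from_top _ _ _ fun σ : Equiv.Perm (Fin b) => σ c).comp (hπ.measurable_perm w)

theorem measure_digit (hπ : IsNestedUniformScrambling P π) (w : List (Fin b)) (c e : Fin b) :
    P ((fun ω => π w ω c) ⁻¹' {e}) = (b : ENNReal)⁻¹ := by
  have hset : (fun ω => π w ω c) ⁻¹' {e} =
      ⋃ σ ∈ Finset.univ.filter fun σ : Equiv.Perm (Fin b) => σ c = e, {ω | π w ω = σ} := by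
    ext ω; simp
  have hb : (b : ENNReal) ≠ 0 := by exact_mod_cast (Fin.pos c).ne'
  rw [hset, measure_biUnion_finset]
  · simp only [hπ.uniform, Finset.sum_const, nsmul_eq_mul]
    rw [← card_perm_apply_eq c e]
    have h0 : ((Finset.univ.filter fun σ : Equiv.Perm (Fin b) => σ c = e).card : ENNReal) ≠ 0 := by
      have := card_perm_apply_eq c e
      have hf := b.factorial_pos
      have : (Finset.univ.filter fun σ : Equiv.Perm (Fin b) => σ c = e).card ≠ 0 := fun h => by
        rw [h] at this; omega
      exact_mod_cast this
    rw [Nat.cast_mul, ENNReal.mul_inv (Or.inl hb) (Or.inl (ENNReal.natCast_ne_top _)),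
      mul_left_comm, ENNReal.mul_inv_cancel h0 (ENNReal.natCast_ne_top _), mul_one]
  · exact fun σ _ τ _ hne => Set.disjoint_left.2 fun ω h h' => hne (h.symm.trans h')
  · exact fun σ _ => hπ.measurableSet_eq w σ

theorem iIndepFun_digit (hπ : IsNestedUniformScrambling P π) {ι : Type*} {w : ι → List (Fin b)}
    (hw : Function.Injective w) (c : ι → Fin b) : iIndepFun (fun i ω => π (w i) ω (c i)) P :=
  (hπ.indep.precomp hw).comp (fun i σ => σ (c i)) fun _ => measurable_from_top

end IsNestedUniformScrambling

/-- The information in the permutations of the words in `T`. -/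
abbrev permSigma {b : ℕ} {Ω' : Type*} (π : List (Fin b) → Ω' → Equiv.Perm (Fin b)) (T : Set (List (Fin b))) :
    MeasurableSpace Ω' :=
  ⨆ w ∈ T, MeasurableSpace.comap (π w) ⊤

theorem measurable_permSigma {b : ℕ} {Ω' : Type*} (π : List (Fin b) → Ω' → Equiv.Perm (Fin b))
    {T : Set (List (Fin b))} {w : List (Fin b)} (hw : w ∈ T) (c : Fin b) :
    Measurable[permSigma π T] fun ω => π w ω c := fun B _ =>
  (le_iSup₂ (f := fun (w : List (Fin b)) (_ : w ∈ T) => MeasurableSpace.comap (π w) ⊤) w hw) _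
    ⟨{σ | σ c ∈ B}, trivial, rfl⟩

variable {b : ℕ} [NeZero b]

/-- The first `j` digits of the `i`-th point of the van der Corput sequence. -/
def vdcWord (b : ℕ) [NeZero b] (i j : ℕ) : List (Fin b) := List.ofFn fun l : Fin j => vdcDigit b i l

theorem vdcWord_length (i j : ℕ) : (vdcWord b i j).length = j := List.length_ofFn

theorem vdcWord_congr {i i' j : ℕ} (h : ∀ l < j, vdcDigit b i l = vdcDigit b i' l) :
    vdcWord b i j = vdcWord b i' j :=
  congrArg List.ofFn (funext fun l => h l l.2)

theorem vdcDigit_of_lt {i m j : ℕ} (hi : i < b ^ m) (hj : m ≤ j) : vdcDigit b i j = 0 := by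
  have : i / b ^ j = 0 :=
    Nat.div_eq_of_lt (hi.trans_le (Nat.pow_le_pow_right (NeZero.pos b) hj))
  simp [vdcDigit, this]

theorem eq_of_vdcDigit_eq {m : ℕ} {i i' : Fin (b ^ m)}
    (h : ∀ l < m, vdcDigit b i l = vdcDigit b i' l) : i = i' := by
  apply finFunctionFinEquiv.symm.injective
  funext l
  have := congrArg Fin.val (h l l.2)
  apply Fin.ext
  rw [finFunctionFinEquiv_symm_apply_val, finFunctionFinEquiv_symm_apply_val]
  simpa [vdcDigit] using this

theorem vdcDigit_eq_of_vdcWord_eq {i i' j j' l : ℕ} (h : vdcWord b i j = vdcWord b i' j')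
    (hl : l < j) : vdcDigit b i l = vdcDigit b i' l := by
  have hj : j = j' := by rw [← vdcWord_length (b := b) i j, h, vdcWord_length]
  subst hj
  exact congrFun (List.ofFn_injective h) ⟨l, hl⟩

section Scrambling

variable {Ω' : Type*} (π : List (Fin b) → Ω' → Equiv.Perm (Fin b))

/-- The index of the interval of length `b ^ (-m)` of the `i`-th scrambled point. -/
def scrambledIndex (m : ℕ) (ω : Ω') (i : Fin (b ^ m)) : Fin (b ^ m) :=
  -- The first digit of a point is the most significant one of its interval index, while
  -- `finFunctionFinEquiv` gives position `l` the weight `b ^ l`; hence the reversal.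
  finFunctionFinEquiv fun l : Fin m =>
    π (vdcWord b i (Fin.rev l)) ω (vdcDigit b i (Fin.rev l))

/-- The relative position of the `i`-th scrambled point in its interval of length `b ^ (-m)`. -/
noncomputable def scrambledTail (m : ℕ) (i : Fin (b ^ m)) (ω : Ω') : ℝ :=
  Real.ofDigits fun j => π (vdcWord b i (j + m)) ω 0

/-- If the digits before `l` agree, the same permutation acts on digit `l` of both points, so equal
outputs force equal digits. -/
theorem scrambledIndex_injective (m : ℕ) (ω : Ω') : Function.Injective (scrambledIndex π m ω) := by
  intro i i' h
  have h1 : ∀ l < m, π (vdcWord b i l) ω (vdcDigit b i l) =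
      π (vdcWord b i' l) ω (vdcDigit b i' l) := fun l hl => by
    have := congrFun (finFunctionFinEquiv.injective h) (Fin.rev ⟨l, hl⟩)
    simpa only [Fin.rev_rev] using this
  refine eq_of_vdcDigit_eq fun l => ?_
  induction l using Nat.strong_induction_on with
  | _ l ih =>
    intro hl
    have h2 := h1 l hl
    rw [vdcWord_congr fun k hk => ih k hk (hk.trans hl)] at h2
    exact (π _ ω).injective h2

/-- The random permutation that sends a point to the index of its interval. -/
noncomputable def scrambledPerm (m : ℕ) (ω : Ω') : Equiv.Perm (Fin (b ^ m)) :=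
  Equiv.ofBijective _ (Finite.injective_iff_bijective.1 (scrambledIndex_injective π m ω))

/-- The first `m` digits form the index. All later digits of `i < b ^ m` vanish, which is why
`scrambledTail` applies its permutations to 0. -/
theorem scrambledVdC_eq (m : ℕ) (i : Fin (b ^ m)) (ω : Ω') :
    scrambledVdC π i ω =
      ((scrambledPerm π m ω i : ℕ) + scrambledTail π m i ω) / ((b ^ m : ℕ) : ℝ) := by
  have hb : (b : ℝ) ≠ 0 := by exact_mod_cast NeZero.ne b
  have e : ((scrambledPerm π m ω i : ℕ) : ℝ) / ((b ^ m : ℕ) : ℝ) = ∑ j ∈ Finset.range m,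
      Real.ofDigitsTerm (fun j => π (vdcWord b i j) ω (vdcDigit b i j)) j := by
    have : (scrambledPerm π m ω i : ℕ) = ∑ l : Fin m,
        (π (vdcWord b i (Fin.rev l)) ω (vdcDigit b i (Fin.rev l)) : ℕ) * b ^ (l : ℕ) :=
      finFunctionFinEquiv_apply _
    rw [this, ← Fin.sum_univ_eq_sum_range, ← Equiv.sum_comp Fin.revPerm, Nat.cast_sum,
      Finset.sum_div]
    refine Finset.sum_congr rfl fun l _ => ?_
    have hl : m = (Fin.rev l : ℕ) + 1 + l := by have := l.2; rw [Fin.val_rev]; omega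
    simp only [Real.ofDigitsTerm, Fin.revPerm_apply, Nat.cast_mul, Nat.cast_pow]
    rw [mul_div_assoc]
    congr 1
    · rw [Fin.rev_rev]
    rw [div_eq_iff (by positivity), eq_comm, inv_mul_eq_iff_eq_mul₀ (by positivity), ← pow_add]
    congr 1
    omega
  rw [add_div, e]
  refine (Real.ofDigits_eq_sum_add_ofDigits _ m).trans ?_
  congr 1
  rw [scrambledTail, div_eq_inv_mul, Nat.cast_pow]
  congr 2
  funext j
  rw [vdcDigit_of_lt i.2 (by omega)]
  rfl

/-- The first `m` scrambled digits use only words of length below `m`; the tails use the others. -/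
theorem measurableSet_scrambledPerm_eq (π : List (Fin b) → Ω' → Equiv.Perm (Fin b)) (m : ℕ)
    (τ : Equiv.Perm (Fin (b ^ m))) :
    MeasurableSet[permSigma π {w | w.length < m}] {ω | scrambledPerm π m ω = τ} := by
  have : {ω | scrambledPerm π m ω = τ} = ⋂ (i : Fin (b ^ m)) (l : Fin m),
      (fun ω => π (vdcWord b i (Fin.rev l)) ω (vdcDigit b i (Fin.rev l))) ⁻¹'
        {finFunctionFinEquiv.symm (τ i) l} := by
    ext ω
    simp only [Set.mem_iInter, Set.mem_preimage, Set.mem_singleton_iff]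
    refine Equiv.ext_iff.trans (forall_congr' fun i => ?_)
    rw [← funext_iff, Equiv.eq_symm_apply]
    rfl
  rw [this]
  refine MeasurableSet.iInter fun i => MeasurableSet.iInter fun l => ?_
  refine measurable_permSigma π ?_ _ (measurableSet_singleton _)
  have := (Fin.rev l).2
  simpa [vdcWord_length] using this

variable {π} [MeasurableSpace Ω'] {P : Measure Ω'}

/-- The first `m` digits determine the point and the length determines the position. So every digit
of every tail comes from its own permutation. -/
theorem vdcWord_injective (m : ℕ) : Function.Injective
    fun p : (_ : Fin (b ^ m)) × ℕ => vdcWord b p.1 (p.2 + m) := by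
  rintro ⟨i, j⟩ ⟨i', j'⟩ h
  simp only at h
  have hi : i = i' := eq_of_vdcDigit_eq fun l hl => vdcDigit_eq_of_vdcWord_eq h (by omega)
  have hj : j = j' := by
    have := congrArg List.length h
    rw [vdcWord_length, vdcWord_length] at this
    omega
  subst hi hj
  rfl

theorem measurable_scrambledTail (hπ : IsNestedUniformScrambling P π) (m : ℕ) (i : Fin (b ^ m)) :
    Measurable (scrambledTail π m i) :=
  Real.continuous_ofDigits.measurable.comp (measurable_pi_iff.2 fun _ => hπ.measurable_digit _ _)

theorem iIndepFun_scrambledTail [IsProbabilityMeasure P] (hπ : IsNestedUniformScrambling P π)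
    (m : ℕ) : iIndepFun (scrambledTail π m) P :=
  (iIndepFun_curry (X := fun (i : Fin (b ^ m)) j ω => π (vdcWord b i (j + m)) ω 0)
    (fun _ _ => hπ.measurable_digit _ _)
    (hπ.iIndepFun_digit (vdcWord_injective m) fun _ => 0)).comp
      (fun _ => Real.ofDigits) fun _ => Real.continuous_ofDigits.measurable

theorem map_scrambledTail [IsProbabilityMeasure P] (hb : 2 ≤ b)
    (hπ : IsNestedUniformScrambling P π) (m : ℕ) (i : Fin (b ^ m)) :
    P.map (scrambledTail π m i) = volume.restrict (Set.Icc (0 : ℝ) 1) :=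
  map_ofDigits_eq_uniform P hb (fun _ => hπ.measurable_digit _ _)
    (hπ.iIndepFun_digit ((vdcWord_injective m).comp (sigma_mk_injective (i := i))) fun _ => 0)
    fun _ _ => hπ.measure_digit _ _ _

/-- The scrambled points are, up to a random order, independent and uniformly distributed on the
intervals of length `b ^ (-m)`. -/
theorem exists_stratified [IsProbabilityMeasure P] (hb : 2 ≤ b)
    (hπ : IsNestedUniformScrambling P π) (m : ℕ) :
    ∃ V : Ω' → Fin (b ^ m) → ℝ, Measurable V ∧
      P.map V = Measure.pi (fun _ => volume.restrict (Set.Icc (0 : ℝ) 1)) ∧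
      ∀ ω (h : ℝ → ℝ), ∑ i ∈ Finset.range (b ^ m), h (scrambledVdC π i ω) =
        ∑ k : Fin (b ^ m), h (((k : ℕ) + V ω k) / ((b ^ m : ℕ) : ℝ)) := by
  have hle : ∀ w, MeasurableSpace.comap (π w) ⊤ ≤ ‹MeasurableSpace Ω'› := fun w =>
    (hπ.measurable_perm w).comap_le
  have hle' : ∀ T, permSigma π T ≤ ‹MeasurableSpace Ω'› := fun T => iSup₂_le fun w _ => hle w
  -- Order and relative positions depend on disjoint families of independent permutations.
  have hindep : Indep (permSigma π {w | w.length < m}) (permSigma π {w | m ≤ w.length}) P :=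
    indep_iSup_of_disjoint hle hπ.indep.iIndep
      (Set.disjoint_left.2 fun w (h : w.length < m) (h' : m ≤ w.length) => absurd h h'.not_gt)
  have htail : Measurable[permSigma π {w | m ≤ w.length}] fun ω i => scrambledTail π m i ω := by
    refine @measurable_pi_lambda _ _ _ (permSigma π {w | m ≤ w.length}) _ _ fun i => ?_
    refine Real.continuous_ofDigits.measurable.comp ?_
    refine @measurable_pi_lambda _ _ _ (permSigma π {w | m ≤ w.length}) _ _ fun j => ?_
    refine measurable_permSigma π ?_ _
    simp [vdcWord_length]
  have hset : ∀ τ, {ω | (scrambledPerm π m ω)⁻¹ = τ} = {ω | scrambledPerm π m ω = τ⁻¹} := fun τ => by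
    ext ω; exact inv_eq_iff_eq_inv
  -- `V ω k` is the tail of the point that falls into interval `k`, whence the inverse permutation.
  obtain ⟨h1, h2⟩ := map_relabel (measurable_scrambledTail hπ m) (iIndepFun_scrambledTail hπ m)
    (map_scrambledTail hb hπ m) (σ := fun ω => (scrambledPerm π m ω)⁻¹)
    (fun τ => by
      rw [hset]
      exact hle' _ _ (measurableSet_scrambledPerm_eq π m _))
    (fun τ B hB => by
      rw [hset]
      exact (Indep_iff _ _ _).1 hindep _ _ (measurableSet_scrambledPerm_eq π m _) (htail hB))
  refine ⟨_, h1, h2, fun ω h => ?_⟩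
  rw [← Fin.sum_univ_eq_sum_range (fun i => h (scrambledVdC π i ω))]
  refine (Finset.sum_congr rfl fun i _ => ?_).trans (Equiv.sum_comp (scrambledPerm π m ω) _)
  have : (scrambledPerm π m ω)⁻¹ (scrambledPerm π m ω i) = i :=
    (scrambledPerm π m ω).symm_apply_apply i
  rw [scrambledVdC_eq, this]

end Scrambling


/-! ### A central limit theorem for bounded triangular arrays -/

/-- Factors are exchanged one at a time; the remaining ones have norm at most one. -/
theorem norm_prod_sub_prod_le {ι : Type*} (s : Finset ι) {a c : ι → ℂ} (ha : ∀ i ∈ s, ‖a i‖ ≤ 1)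
    (hc : ∀ i ∈ s, ‖c i‖ ≤ 1) : ‖∏ i ∈ s, a i - ∏ i ∈ s, c i‖ ≤ ∑ i ∈ s, ‖a i - c i‖ := by
  classical
  induction s using Finset.induction_on with
  | empty => simp
  | insert i s hi ih =>
    have h1 := ih (fun j hj => ha j (Finset.mem_insert_of_mem hj))
      fun j hj => hc j (Finset.mem_insert_of_mem hj)
    have h2 : ‖∏ j ∈ s, c j‖ ≤ 1 := by
      rw [norm_prod]
      exact Finset.prod_le_one (fun _ _ => norm_nonneg _)
        fun j hj => hc j (Finset.mem_insert_of_mem hj)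
    rw [Finset.prod_insert hi, Finset.prod_insert hi, Finset.sum_insert hi]
    calc ‖a i * ∏ j ∈ s, a j - c i * ∏ j ∈ s, c j‖
        = ‖(a i - c i) * ∏ j ∈ s, c j + a i * (∏ j ∈ s, a j - ∏ j ∈ s, c j)‖ := by
          congr 1; ring
      _ ≤ ‖a i - c i‖ * ‖∏ j ∈ s, c j‖ + ‖a i‖ * ‖∏ j ∈ s, a j - ∏ j ∈ s, c j‖ := by
          rw [← norm_mul, ← norm_mul]; exact norm_add_le _ _
      _ ≤ ‖a i - c i‖ + ∑ j ∈ s, ‖a j - c j‖ := by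
          refine add_le_add (mul_le_of_le_one_right (norm_nonneg _) h2) ?_
          exact (mul_le_of_le_one_left (norm_nonneg _) (ha i (Finset.mem_insert_self i s))).trans h1

theorem norm_exp_mul_I_sub_taylor_le {y : ℝ} (hy : |y| ≤ 1) :
    ‖Complex.exp (y * Complex.I) - (1 + y * Complex.I - (y ^ 2 / 2 : ℝ))‖ ≤ 3 * |y| ^ 3 := by
  have h := Complex.norm_exp_sub_sum_le_norm_mul_exp (y * Complex.I) 3
  have hs : ∑ k ∈ Finset.range 3, (y * Complex.I) ^ k / (k.factorial : ℂ) =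
      1 + y * Complex.I - (y ^ 2 / 2 : ℝ) := by
    simp only [Finset.sum_range_succ, Finset.sum_range_zero, mul_pow, Complex.I_sq, pow_zero,
      pow_one, Nat.factorial]
    push_cast
    ring
  have hn : ‖(y : ℂ) * Complex.I‖ = |y| := by simp
  rw [hs, hn] at h
  have he : Real.exp |y| ≤ 3 := (Real.exp_le_exp.2 hy).trans Real.exp_one_lt_three.le
  nlinarith [pow_nonneg (abs_nonneg y) 3]

/-- Both terms are close to `1 - v u ^ 2 / 2`. The characteristic function is within `3 |u| ^ 3 v`,
by Taylor expansion, mean zero and `|X| ^ 3 ≤ X ^ 2`; the exponential is within `|u| ^ 3 v`, as `v ≤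
1` and `|u| ≤ 1`. A bound linear in `v` can be summed over the array. -/
theorem norm_charFun_sub_exp_le {A : Type*} [MeasurableSpace A] {μ : Measure A}
    [IsProbabilityMeasure μ] {X : A → ℝ} (hX : AEMeasurable X μ) (hb : ∀ a, |X a| ≤ 1)
    (h0 : ∫ a, X a ∂μ = 0) {u : ℝ} (hu : |u| ≤ 1) :
    ‖charFun (μ.map X) u - Complex.exp (-((∫ a, X a ^ 2 ∂μ) * u ^ 2 / 2 : ℝ))‖ ≤
      4 * |u| ^ 3 * ∫ a, X a ^ 2 ∂μ := by
  set v := ∫ a, X a ^ 2 ∂μ with hv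
  have hi1 : Integrable X μ := Integrable.of_bound hX.aestronglyMeasurable 1
    (Eventually.of_forall hb)
  have hsq : ∀ a, X a ^ 2 ≤ 1 := fun a => (sq_le_one_iff_abs_le_one _).2 (hb a)
  have hi2 : Integrable (fun a => X a ^ 2) μ := Integrable.of_bound
    (hX.pow_const 2).aestronglyMeasurable 1 (Eventually.of_forall fun a => by
      rw [Real.norm_eq_abs, abs_of_nonneg (sq_nonneg _)]; exact hsq a)
  have hv0 : 0 ≤ v := integral_nonneg fun a => sq_nonneg _
  have hv1 : v ≤ 1 := by
    have := integral_mono hi2 (integrable_const (1 : ℝ)) hsq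
    simpa using this
  have hphi : charFun (μ.map X) u = ∫ a, Complex.exp ((u * X a : ℝ) * Complex.I) ∂μ := by
    rw [charFun_apply_real, integral_map hX (by fun_prop)]
    push_cast
    rfl
  have hmexp : AEStronglyMeasurable (fun a => Complex.exp ((u * X a : ℝ) * Complex.I)) μ :=
    AEMeasurable.aestronglyMeasurable (by fun_prop)
  have hie : Integrable (fun a => Complex.exp ((u * X a : ℝ) * Complex.I)) μ :=
    Integrable.of_bound hmexp 1 (Eventually.of_forall fun a =>
      (Complex.norm_exp_ofReal_mul_I _).le)
  have hiX : Integrable (fun a => ((u * X a : ℝ) : ℂ) * Complex.I) μ :=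
    ((hi1.const_mul u).ofReal).mul_const _
  have hiX2 : Integrable (fun a => (((u * X a) ^ 2 / 2 : ℝ) : ℂ)) μ := by
    refine Integrable.ofReal ?_
    simp_rw [mul_pow]
    exact (hi2.const_mul _).div_const _
  have hi1X : Integrable (fun a => (1 + (u * X a : ℝ) * Complex.I : ℂ)) μ :=
    (integrable_const 1).add hiX
  have hit : Integrable (fun a => (1 + (u * X a : ℝ) * Complex.I - ((u * X a) ^ 2 / 2 : ℝ) : ℂ)) μ :=
    hi1X.sub hiX2
  have htay : ∫ a, (1 + (u * X a : ℝ) * Complex.I - ((u * X a) ^ 2 / 2 : ℝ) : ℂ) ∂μ =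
      ((1 - v * u ^ 2 / 2 : ℝ) : ℂ) := by
    rw [integral_sub hi1X hiX2, integral_add (integrable_const 1) hiX,
      integral_mul_const, integral_complex_ofReal, integral_complex_ofReal, integral_const_mul, h0,
      integral_div]
    simp_rw [mul_pow]
    rw [integral_const_mul, ← hv]
    simp
    ring
  have h1 : ‖charFun (μ.map X) u - ((1 - v * u ^ 2 / 2 : ℝ) : ℂ)‖ ≤ 3 * |u| ^ 3 * v := by
    rw [hphi, ← htay, ← integral_sub hie hit]
    refine (norm_integral_le_integral_norm _).trans ?_
    rw [hv, ← integral_const_mul]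
    refine integral_mono (hie.sub hit).norm (hi2.const_mul _) fun a => ?_
    have hua : |u * X a| ≤ 1 := by
      rw [abs_mul]; exact mul_le_one₀ hu (abs_nonneg _) (hb a)
    refine (norm_exp_mul_I_sub_taylor_le hua).trans ?_
    rw [abs_mul, mul_pow, ← sq_abs (X a), mul_assoc]
    have := pow_le_pow_of_le_one (abs_nonneg (X a)) (hb a) (show 2 ≤ 3 by norm_num)
    gcongr
  have hu2 : u ^ 2 ≤ 1 := (sq_le_one_iff_abs_le_one _).2 hu
  have h2 : ‖((1 - v * u ^ 2 / 2 : ℝ) : ℂ) - Complex.exp (-(v * u ^ 2 / 2 : ℝ))‖ ≤ |u| ^ 3 * v := by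
    rw [← Complex.ofReal_neg, ← Complex.ofReal_exp, ← Complex.ofReal_sub, Complex.norm_real,
      Real.norm_eq_abs, abs_sub_comm]
    have hy0 : 0 ≤ v * u ^ 2 / 2 := by positivity
    have hy1 : v * u ^ 2 / 2 ≤ 1 := by nlinarith
    have := Real.abs_exp_sub_one_sub_id_le (x := -(v * u ^ 2 / 2))
      (by rw [abs_neg, abs_of_nonneg hy0]; exact hy1)
    rw [show Real.exp (-(v * u ^ 2 / 2)) - (1 - v * u ^ 2 / 2) =
      Real.exp (-(v * u ^ 2 / 2)) - 1 - -(v * u ^ 2 / 2) by ring]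
    refine this.trans ?_
    have h4 := pow_le_pow_of_le_one (abs_nonneg u) hu (show 3 ≤ 4 by norm_num)
    have h44 : |u| ^ 4 = u ^ 4 := by
      rw [← abs_pow]
      exact abs_of_nonneg (by positivity)
    have hvv : v * v ≤ v := mul_le_of_le_one_right hv0 hv1
    calc (-(v * u ^ 2 / 2)) ^ 2 = (v * v) * |u| ^ 4 / 4 := by rw [h44]; ring
      _ ≤ (v * v) * |u| ^ 4 := div_le_self (by positivity) (by norm_num)
      _ ≤ v * |u| ^ 3 := mul_le_mul hvv h4 (by positivity) hv0
      _ = |u| ^ 3 * v := mul_comm _ _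
  calc _ ≤ _ := norm_sub_le_norm_sub_add_norm_sub _ ((1 - v * u ^ 2 / 2 : ℝ) : ℂ) _
    _ ≤ _ := add_le_add h1 h2
    _ = _ := by ring

theorem norm_charFun_sum_sub_exp_le {A ι : Type*} [MeasurableSpace A] {μ : Measure A}
    [IsProbabilityMeasure μ] [Fintype ι] {X : ι → A → ℝ} (hX : ∀ k, AEMeasurable (X k) μ)
    (hi : iIndepFun X μ) (hb : ∀ k a, |X k a| ≤ 1) (h0 : ∀ k, ∫ a, X k a ∂μ = 0) {u : ℝ}
    (hu : |u| ≤ 1) :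
    ‖charFun (μ.map fun a => ∑ k, X k a) u -
        Complex.exp (-((∑ k, ∫ a, X k a ^ 2 ∂μ) * u ^ 2 / 2 : ℝ))‖ ≤
      4 * |u| ^ 3 * ∑ k, ∫ a, X k a ^ 2 ∂μ := by
  have hexp : Complex.exp (-((∑ k, ∫ a, X k a ^ 2 ∂μ) * u ^ 2 / 2 : ℝ)) =
      ∏ k, Complex.exp (-((∫ a, X k a ^ 2 ∂μ) * u ^ 2 / 2 : ℝ)) := by
    rw [← Complex.exp_sum, Finset.sum_neg_distrib, ← Complex.ofReal_sum, Finset.sum_mul,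
      Finset.sum_div]
  have hp : ∀ k, IsProbabilityMeasure (μ.map (X k)) :=
    fun k => Measure.isProbabilityMeasure_map (hX k)
  rw [hi.charFun_map_fun_sum_eq_prod hX, hexp, Finset.prod_apply, Finset.mul_sum]
  refine (norm_prod_sub_prod_le _ (fun k _ => norm_charFun_le_one _) fun k _ => ?_).trans
    (Finset.sum_le_sum fun k _ => norm_charFun_sub_exp_le (hX k) (hb k) (h0 k) hu)
  rw [← Complex.ofReal_neg, ← Complex.ofReal_exp, Complex.norm_real, Real.norm_eq_abs,
    Real.abs_exp, Real.exp_le_one_iff]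
  have : 0 ≤ ∫ a, X k a ^ 2 ∂μ := integral_nonneg fun a => sq_nonneg _
  have : 0 ≤ (∫ a, X k a ^ 2 ∂μ) * u ^ 2 / 2 := by positivity
  linarith

/-- The central limit theorem for triangular arrays of independent, centred random variables bounded
by one whose total variance tends to infinity, in terms of characteristic functions. -/
theorem tendsto_charFun_of_bounded {A ι : ℕ → Type*} [∀ m, MeasurableSpace (A m)]
    {μ : ∀ m, Measure (A m)} [∀ m, IsProbabilityMeasure (μ m)] [∀ m, Fintype (ι m)]
    {X : ∀ m, ι m → A m → ℝ} (hX : ∀ m k, AEMeasurable (X m k) (μ m))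
    (hi : ∀ m, iIndepFun (X m) (μ m)) (hb : ∀ m k a, |X m k a| ≤ 1)
    (h0 : ∀ m k, ∫ a, X m k a ∂(μ m) = 0) {v : ℕ → ℝ}
    (hv : ∀ m, v m = ∑ k, ∫ a, X m k a ^ 2 ∂(μ m)) (hlim : Tendsto v atTop atTop) (t : ℝ) :
    Tendsto (fun m => charFun ((μ m).map fun a => (√(v m))⁻¹ * ∑ k, X m k a) t) atTop
      (𝓝 (Complex.exp (-(t ^ 2 / 2 : ℝ)))) := by
  have hs : Tendsto (fun m => √(v m)) atTop atTop := Real.tendsto_sqrt_atTop.comp hlim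
  rw [tendsto_iff_norm_sub_tendsto_zero]
  have hlim0 : Tendsto (fun m => 4 * |t| ^ 3 * (√(v m))⁻¹) atTop (𝓝 0) := by
    simpa using (tendsto_inv_atTop_zero.comp hs).const_mul (4 * |t| ^ 3)
  refine squeeze_zero' (Eventually.of_forall fun m => norm_nonneg _) ?_ hlim0
  filter_upwards [hs.eventually_ge_atTop |t|, hs.eventually_gt_atTop 0] with m hm hpos
  have hsq : √(v m) ^ 2 = v m := Real.sq_sqrt (Real.sqrt_pos.1 hpos).le
  have hu : |(√(v m))⁻¹ * t| ≤ 1 := by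
    rw [abs_mul, abs_inv, abs_of_pos hpos, inv_mul_le_one₀ hpos]
    exact hm
  have h := norm_charFun_sum_sub_exp_le (hX m) (hi m) (hb m) (h0 m) hu
  rw [← hv m] at h
  rw [charFun_map_mul_comp (Finset.aemeasurable_fun_sum _ fun k _ => hX m k)]
  -- At `u = t / √v` the Gaussian exponent is exact, and the error `4 |u| ^ 3 v` becomes `4 |t| ^ 3
  -- / √v`.
  have e1 : v m * ((√(v m))⁻¹ * t) ^ 2 / 2 = t ^ 2 / 2 := by
    rw [← hsq]; field_simp; rw [Real.sqrt_sq hpos.le]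
  have e2 : 4 * |(√(v m))⁻¹ * t| ^ 3 * v m = 4 * |t| ^ 3 * (√(v m))⁻¹ := by
    rw [abs_mul, abs_inv, abs_of_pos hpos, ← hsq, Real.sqrt_sq hpos.le]; field_simp
  rwa [e1, e2] at h


/-! ### The strata of the indicator function -/

/-- The indicator of `Ω` at the point of relative position `u` in the `k`-th stratum. -/
noncomputable def cellFun {d : ℕ} (S : HilbertScheme d) (Ω : Set (Fin d → ℝ)) (n k : ℕ) (u : ℝ) : ℝ :=
  ind Ω (S.curve (((k : ℝ) + u) / n))

theorem ind_mem_Icc {d : ℕ} (Ω : Set (Fin d → ℝ)) (x : Fin d → ℝ) :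
    ind Ω x ∈ Set.Icc (0 : ℝ) 1 := by
  unfold ind
  by_cases h : x ∈ Ω <;> simp [h]

theorem aemeasurable_ind {d : ℕ} {Ω : Set (Fin d → ℝ)} (hΩm : NullMeasurableSet Ω volume) :
    AEMeasurable (ind Ω) volume :=
  aemeasurable_const.indicator₀ hΩm

section Cells

variable {d : ℕ} (S : HilbertScheme d) {Ω : Set (Fin d → ℝ)}

/-- `Ω` is only Lebesgue measurable, so composing with the curve needs the image law to be
absolutely continuous; it is, being uniform on a stratum. -/
theorem aemeasurable_ind_map (hd : 1 ≤ d) (hΩm : NullMeasurableSet Ω volume) {n k : ℕ}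
    (hk : k < n) : AEMeasurable (ind Ω)
      ((volume.restrict (Set.Icc (0 : ℝ) 1)).map fun u => S.curve (((k : ℝ) + u) / n)) := by
  rw [S.map_curve_affine hd hk]
  exact (aemeasurable_ind hΩm).mono_ac cond_absolutelyContinuous

theorem measurable_curve_affine (n k : ℕ) :
    Measurable fun u : ℝ => S.curve (((k : ℝ) + u) / n) :=
  S.continuous_curve.measurable.comp (by fun_prop)

theorem aemeasurable_cellFun (hd : 1 ≤ d) (hΩm : NullMeasurableSet Ω volume) {n k : ℕ}
    (hk : k < n) : AEMeasurable (cellFun S Ω n k) (volume.restrict (Set.Icc (0 : ℝ) 1)) :=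
  (aemeasurable_ind_map S hd hΩm hk).comp_measurable (measurable_curve_affine S n k)

theorem integrable_cellFun (hd : 1 ≤ d) (hΩm : NullMeasurableSet Ω volume) {n k : ℕ}
    (hk : k < n) : Integrable (cellFun S Ω n k) (volume.restrict (Set.Icc (0 : ℝ) 1)) :=
  Integrable.of_bound (aemeasurable_cellFun S hd hΩm hk).aestronglyMeasurable 1
    (Eventually.of_forall fun u => by
      have h : cellFun S Ω n k u ∈ Set.Icc (0 : ℝ) 1 := ind_mem_Icc _ _
      rw [Real.norm_eq_abs, abs_le]
      exact ⟨by linarith [h.1], h.2⟩)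

theorem variance_cellFun (hd : 1 ≤ d) (hΩm : NullMeasurableSet Ω volume) {n k : ℕ} (hk : k < n) :
    variance (cellFun S Ω n k) (volume.restrict (Set.Icc (0 : ℝ) 1)) = cellVariance S Ω n k := by
  rw [cellVariance, ← S.map_curve_affine hd hk, variance_map (aemeasurable_ind_map S hd hΩm hk)
    (measurable_curve_affine S n k).aemeasurable]
  rfl

theorem sum_integral_cellFun (hΩm : NullMeasurableSet Ω volume) {n : ℕ} (hn : 0 < n) :
    ∑ k : Fin n, ∫ u in Set.Icc (0 : ℝ) 1, cellFun S Ω n k u =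
      n * ∫ x in Set.Icc (0 : Fin d → ℝ) 1, ind Ω x := by
  have hm : AEStronglyMeasurable (ind Ω) ((volume.restrict (Set.Icc (0 : ℝ) 1)).map S.curve) := by
    rw [S.map_curve]
    exact (aemeasurable_ind hΩm).restrict.aestronglyMeasurable
  have hint : IntegrableOn (fun x => ind Ω (S.curve x)) (Set.Icc 0 1) :=
    Integrable.of_bound (hm.comp_aemeasurable S.continuous_curve.aemeasurable) 1
      (Eventually.of_forall fun u => by
        have h := ind_mem_Icc Ω (S.curve u)
        rw [Real.norm_eq_abs, abs_le]
        exact ⟨by linarith [h.1], h.2⟩)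
  rw [← S.map_curve, integral_map S.continuous_curve.aemeasurable hm]
  exact sum_integral_affine hint hn

/-- The centred indicator of the `k`-th stratum, as a function on the product space. -/
noncomputable def centredCell (S : HilbertScheme d) (Ω : Set (Fin d → ℝ)) (n : ℕ) (k : Fin n)
    (v : Fin n → ℝ) : ℝ :=
  cellFun S Ω n k (v k) - ∫ u in Set.Icc (0 : ℝ) 1, cellFun S Ω n k u

/-- The law of `n` independent uniform points in `[0,1]`. -/
noncomputable abbrev uniformPi (n : ℕ) : Measure (Fin n → ℝ) :=
  Measure.pi fun _ => volume.restrict (Set.Icc (0 : ℝ) 1)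

theorem abs_centredCell_le (n : ℕ) (k : Fin n) (v : Fin n → ℝ) :
    |centredCell S Ω n k v| ≤ 1 := by
  have h : ∀ u, cellFun S Ω n k u ∈ Set.Icc (0 : ℝ) 1 := fun u => ind_mem_Icc _ _
  have h0 : 0 ≤ ∫ u in Set.Icc (0 : ℝ) 1, cellFun S Ω n k u := integral_nonneg fun u => (h u).1
  have h1 : ∫ u in Set.Icc (0 : ℝ) 1, cellFun S Ω n k u ≤ 1 := by
    have := integral_mono_of_nonneg (μ := volume.restrict (Set.Icc (0 : ℝ) 1))
      (Eventually.of_forall fun u => (h u).1) (integrable_const (1 : ℝ))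
      (Eventually.of_forall fun u => (h u).2)
    simpa using this
  rw [centredCell, abs_le]
  constructor <;> linarith [(h (v k)).1, (h (v k)).2]

theorem aemeasurable_centredCell (hd : 1 ≤ d) (hΩm : NullMeasurableSet Ω volume) (n : ℕ)
    (k : Fin n) : AEMeasurable (centredCell S Ω n k) (uniformPi n) :=
  ((aemeasurable_cellFun S hd hΩm k.2).comp_quasiMeasurePreserving
    (measurePreserving_eval _ k).quasiMeasurePreserving).sub_const _

theorem iIndepFun_centredCell (hd : 1 ≤ d) (hΩm : NullMeasurableSet Ω volume) (n : ℕ) :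
    iIndepFun (centredCell S Ω n) (uniformPi n) :=
  iIndepFun_pi (X := fun (k : Fin n) u =>
      cellFun S Ω n k u - ∫ u in Set.Icc (0 : ℝ) 1, cellFun S Ω n k u)
    fun k => (aemeasurable_cellFun S hd hΩm k.2).sub_const _

theorem integral_eval {n : ℕ} (k : Fin n) {h : ℝ → ℝ}
    (hh : AEMeasurable h (volume.restrict (Set.Icc (0 : ℝ) 1))) :
    ∫ v, h (v k) ∂(uniformPi n) = ∫ u in Set.Icc (0 : ℝ) 1, h u := by
  have hp := measurePreserving_eval (fun _ : Fin n => volume.restrict (Set.Icc (0 : ℝ) 1)) k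
  rw [← hp.map_eq] at hh
  have := integral_map hp.measurable.aemeasurable hh.aestronglyMeasurable
  rw [hp.map_eq] at this
  exact this.symm

theorem integral_centredCell (hd : 1 ≤ d) (hΩm : NullMeasurableSet Ω volume) (n : ℕ) (k : Fin n) :
    ∫ v, centredCell S Ω n k v ∂(uniformPi n) = 0 := by
  refine (integral_eval k ((aemeasurable_cellFun S hd hΩm k.2).sub_const _)).trans ?_
  rw [integral_sub (integrable_cellFun S hd hΩm k.2) (integrable_const _)]
  simp

theorem integral_centredCell_sq (hd : 1 ≤ d) (hΩm : NullMeasurableSet Ω volume) (n : ℕ)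
    (k : Fin n) : ∫ v, centredCell S Ω n k v ^ 2 ∂(uniformPi n) = cellVariance S Ω n k := by
  rw [← variance_cellFun S hd hΩm k.2, variance_eq_integral (aemeasurable_cellFun S hd hΩm k.2)]
  exact integral_eval k (((aemeasurable_cellFun S hd hΩm k.2).sub_const _).pow_const 2)

theorem variance_sum_centredCell (hd : 1 ≤ d) (hΩm : NullMeasurableSet Ω volume) (n : ℕ) :
    variance (fun v => ∑ k, centredCell S Ω n k v) (uniformPi n) =
      ∑ k : Fin n, cellVariance S Ω n k := by
  have hmem : ∀ k, MemLp (centredCell S Ω n k) 2 (uniformPi n) := fun k =>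
    MemLp.of_bound (aemeasurable_centredCell S hd hΩm n k).aestronglyMeasurable 1
      (Eventually.of_forall fun v => abs_centredCell_le S n k v)
  have hi := iIndepFun_centredCell S hd hΩm n
  have := IndepFun.variance_sum (s := Finset.univ) (X := centredCell S Ω n) (μ := uniformPi n)
    (fun k _ => hmem k) fun i _ j _ hij => hi.indepFun hij
  have e : (fun v => ∑ k, centredCell S Ω n k v) = ∑ k, centredCell S Ω n k := by
    ext v; simp
  rw [e, this]
  refine Finset.sum_congr rfl fun k _ => ?_
  rw [variance_eq_integral (aemeasurable_centredCell S hd hΩm n k), integral_centredCell S hd hΩm,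
    ← integral_centredCell_sq S hd hΩm n k]
  simp

/-- The remaining cells have nonnegative variance and can be dropped. -/
theorem le_sum_cellVariance {n : ℕ} {c : ℝ}
    (h : ∀ i ∈ boundaryCells S Ω n, c ≤ cellVariance S Ω n i) :
    c * (boundaryCells S Ω n).ncard ≤ ∑ k : Fin n, cellVariance S Ω n k := by
  classical
  have hset : boundaryCells S Ω n =
      ((Finset.range n).filter fun i => i ∈ boundaryCells S Ω n : Finset ℕ) := by
    ext i
    simp only [Finset.coe_filter, Finset.mem_range]
    exact ⟨fun hi => ⟨hi.1, hi⟩, fun hi => hi.2⟩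
  rw [Fin.sum_univ_eq_sum_range (fun k => cellVariance S Ω n k)]
  have hcard : (boundaryCells S Ω n).ncard =
      ((Finset.range n).filter fun i => i ∈ boundaryCells S Ω n).card := by
    conv_lhs => rw [hset]
    exact Set.ncard_coe_finset _
  rw [hcard, mul_comm, ← nsmul_eq_mul]
  refine (Finset.card_nsmul_le_sum _ _ _ fun i hi => h i (Finset.mem_filter.1 hi).2).trans ?_
  exact Finset.sum_le_sum_of_subset_of_nonneg (Finset.filter_subset _ _)
    fun i _ _ => variance_nonneg _ _

theorem tendsto_sum_cellVariance {b : ℕ} (hb : 2 ≤ b) (hA : BoundaryAssumption S b Ω) :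
    Tendsto (fun m => ∑ k : Fin (b ^ m), cellVariance S Ω (b ^ m) k) atTop atTop := by
  obtain ⟨c, hc, N₀, -, h⟩ := hA.lower_bound
  have h1 : Tendsto (fun m => c * ((boundaryCells S Ω (b ^ m)).ncard : ℝ)) atTop atTop :=
    (tendsto_natCast_atTop_atTop.comp hA.tendsto_ncard).const_mul_atTop hc
  refine tendsto_atTop_mono' _ ?_ h1
  filter_upwards [(tendsto_pow_atTop_atTop_of_one_lt (by omega : 1 < b)).eventually_ge_atTop N₀]
    with m hm
  exact le_sum_cellVariance S (h m hm)

end Cells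

/-- The standardized estimate is, in terms of the uniform positions `V` in the strata, the
standardized sum of the centred indicators. -/
theorem standardized_estimate_eq {d b : ℕ} [NeZero b] (hd : 1 ≤ d) (S : HilbertScheme d)
    {Ω : Set (Fin d → ℝ)} (hΩm : NullMeasurableSet Ω volume) {Ω' : Type*} [MeasurableSpace Ω']
    {P : Measure Ω'} [IsProbabilityMeasure P] {π : List (Fin b) → Ω' → Equiv.Perm (Fin b)} {n : ℕ}
    (hn : 0 < n) {V : Ω' → Fin n → ℝ} (hV : Measurable V) (hlaw : P.map V = uniformPi n)
    (hsum : ∀ ω (h : ℝ → ℝ), ∑ i ∈ Finset.range n, h (scrambledVdC π i ω) =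
        ∑ k : Fin n, h (((k : ℕ) + V ω k) / (n : ℝ))) :
    (fun ω => (estimate S π (ind Ω) n ω - ∫ x in Set.Icc (0 : Fin d → ℝ) 1, ind Ω x) /
      √(variance (estimate S π (ind Ω) n) P)) =
    (fun v => (√(∑ k : Fin n, cellVariance S Ω n k))⁻¹ *
      ∑ k, centredCell S Ω n k v) ∘ V := by
  have hn' : (0 : ℝ) < n := by exact_mod_cast hn
  set I := ∫ x in Set.Icc (0 : Fin d → ℝ) 1, ind Ω x with hI
  -- The centring constants add up to `n * I`, by `sum_integral_cellFun`.
  have hest : ∀ ω, estimate S π (ind Ω) n ω =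
      1 / n * (∑ k, centredCell S Ω n k (V ω)) + I := fun ω => by
    rw [estimate, hsum ω fun x => ind Ω (S.curve x)]
    simp only [centredCell]
    rw [Finset.sum_sub_distrib, sum_integral_cellFun S hΩm hn, mul_sub, ← hI, ← mul_assoc,
      one_div_mul_cancel hn'.ne', one_mul, sub_add_cancel]
    rfl
  have hmG : AEMeasurable (fun v => ∑ k, centredCell S Ω n k v) (uniformPi n) :=
    Finset.aemeasurable_fun_sum _ fun k _ => aemeasurable_centredCell S hd hΩm n k
  have hmGV : AEMeasurable (fun v => ∑ k, centredCell S Ω n k v) (P.map V) := by rwa [hlaw]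
  have hvar : variance (estimate S π (ind Ω) n) P =
      (1 / n : ℝ) ^ 2 * ∑ k : Fin n, cellVariance S Ω n k := by
    have hmc : AEMeasurable (fun ω => 1 / (n : ℝ) * ∑ k, centredCell S Ω n k (V ω)) P :=
      (hmGV.comp_measurable hV).const_mul _
    rw [funext hest, variance_add_const hmc.aestronglyMeasurable,
      variance_const_mul, ← variance_sum_centredCell S hd hΩm n, ← hlaw,
      variance_map hmGV hV.aemeasurable]
    rfl
  funext ω
  -- The factor `1 / n` cancels. The identity also holds for zero variance, where both sides are 0
  -- by convention.
  rw [hvar, hest, add_sub_cancel_right, Real.sqrt_mul (by positivity), Real.sqrt_sq (by positivity),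
    mul_div_mul_left _ _ (by positivity), Function.comp, div_eq_inv_mul]

end HSFC

/-! ### The central limit theorem for the scrambled estimate -/

theorem mainTheorem4 {d b : ℕ} [NeZero b] (hd : 1 ≤ d) (hb : 2 ≤ b)
    (S : HSFC.HilbertScheme d)
    (Ω : Set (Fin d → ℝ)) (hΩ : Ω ⊆ Set.Icc 0 1) (hΩm : NullMeasurableSet Ω volume)
    (hA : HSFC.BoundaryAssumption S b Ω)
    {Ω' : Type*} [MeasurableSpace Ω'] (P : Measure Ω') [IsProbabilityMeasure P]
    (π : List (Fin b) → Ω' → Equiv.Perm (Fin b)) (hπ : HSFC.IsNestedUniformScrambling P π) :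
    TendstoInDistribution
      (fun (m : ℕ) (ω : Ω') =>
        (HSFC.estimate S π (HSFC.ind Ω) (b ^ m) ω - ∫ x in Set.Icc (0 : Fin d → ℝ) 1, HSFC.ind Ω x) /
          √(variance (HSFC.estimate S π (HSFC.ind Ω) (b ^ m)) P))
      atTop (id : ℝ → ℝ) (fun _ => P) (gaussianReal 0 1) := by
  choose V hV hlaw hsum using fun m => HSFC.exists_stratified (P := P) hb hπ m
  have heq := fun m => HSFC.standardized_estimate_eq hd S hΩm (pow_pos (NeZero.pos b) m) (hV m) (hlaw m) (hsum m)
  have hmG : ∀ m, AEMeasurable (fun v => (√(∑ k : Fin (b ^ m),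
      HSFC.cellVariance S Ω (b ^ m) k))⁻¹ * ∑ k, HSFC.centredCell S Ω (b ^ m) k v)
        (P.map (V m)) := fun m => by
    rw [hlaw m]
    exact (Finset.aemeasurable_fun_sum _ fun k _ =>
      HSFC.aemeasurable_centredCell S hd hΩm (b ^ m) k).const_mul _
  refine ⟨fun m => ?_, aemeasurable_id, ?_⟩
  · rw [heq m]
    exact (hmG m).comp_measurable (hV m)
  -- By Lévy's continuity theorem it suffices to treat characteristic functions, which depend on `V
  -- m` only through its law `uniformPi (b ^ m)`.
  refine ProbabilityMeasure.tendsto_iff_tendsto_charFun.2 fun t => ?_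
  have hclt := HSFC.tendsto_charFun_of_bounded (μ := fun m => HSFC.uniformPi (b ^ m))
    (X := fun m => HSFC.centredCell S Ω (b ^ m))
    (fun m k => HSFC.aemeasurable_centredCell S hd hΩm (b ^ m) k)
    (fun m => HSFC.iIndepFun_centredCell S hd hΩm (b ^ m))
    (fun m k v => HSFC.abs_centredCell_le S (b ^ m) k v)
    (fun m k => HSFC.integral_centredCell S hd hΩm (b ^ m) k)
    (fun m => (Finset.sum_congr rfl fun k _ =>
      HSFC.integral_centredCell_sq S hd hΩm (b ^ m) k).symm)
    (HSFC.tendsto_sum_cellVariance S hb hA) t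
  simp only [ProbabilityMeasure.coe_mk, Measure.map_id]
  rw [charFun_gaussianReal]
  convert hclt using 2 with m
  · rw [heq m, ← AEMeasurable.map_map_of_aemeasurable (hmG m) (hV m).aemeasurable, hlaw m]
  · push_cast
    simp
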